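/- Let $c\in\mathbb R$ and let $b=\mathbf 1_{(1/2,1]}$. On the Hilbert space $\mathcal H=(H^1_0(0,1)\times L^2(0,1))^2$ (complex-valued functions), with elements written $U=(u,v,y,z)$ and norm $\|U\|_{\mathcal H}^2=\int_0^1(|u_x|^2+|v|^2+|y_x|^2+|z|^2)\,dx$, consider the unbounded operator $$\mathcal A(u,v,y,z)=\bigl(v,\ (u_x+b\,v_x)_x-c\,z,\ z,\ y_{xx}+c\,v\bigr)$$ with domain $$D(\mathcal A)=\{(u,v,y,z)\in\mathcal H:\ v,z\in H^1_0(0,1),\ y\in H^2(0,1),\ (u_x+b\,v_x)_x\in L^2(0,1)\}.$$ It is associated with the wave system $u_{tt}-(u_x+b(x)u_{tx})_x+c\,y_t=0$, $y_{tt}-y_{xx}-c\,u_t=0$ on $(0,1)$ with homogeneous Dirichlet boundary conditions: equal speeds $a=1$, local Kelvin–Voigt damping $b$, global coupling $c$. Then $\mathcal A$ generates a $C_0$-semigroup of contractions $(e^{t\mathcal A})_{t\ge0}$ on $\mathcal H$, and this semigroup is not exponentially stable: there are no constants $M,\varepsilon>0$ such that $\|e^{t\mathcal A}U_0\|_{\mathcal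 H}\le Me^{-\varepsilon t}\|U_0\|_{\mathcal H}$ for all $t>0$ and all $U_0\in\mathcal H$. Moreover, $\mathcal A$ has a sequence of eigenvalues $(\lambda_n)$ with $|\lambda_n|\to\infty$ and $\operatorname{Re}\lambda_n\to0$. -/

import Mathlib

open MeasureTheory Set Filter Topology
open scoped NNReal ContDiff

noncomputable section

namespace KelvinVoigt

/-! ### One-dimensional Sobolev spaces on `(0,1)` -/

/-- Lebesgue measure on the interval `(0,1)`. -/
abbrev mu : Measure ℝ := volume.restrict (Ioo (0 : ℝ) 1)

/-- The complex Hilbert space `L²(0,1)`. -/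
abbrev L2 : Type := Lp ℂ 2 mu

/-- Test functions: complex valued, smooth, with compact support contained in `(0,1)`. -/
structure IsTest (φ : ℝ → ℂ) : Prop where
  smooth : ContDiff ℝ ∞ φ
  compact : HasCompactSupport φ
  supp : tsupport φ ⊆ Ioo (0 : ℝ) 1

/-- `g` is the weak (distributional) derivative of `f` on `(0,1)`. -/
def IsWeakDeriv (f g : ℝ → ℂ) : Prop :=
  ∀ φ : ℝ → ℂ, IsTest φ → ∫ x, f x * deriv φ x ∂mu = -∫ x, g x * φ x ∂mu

lemma IsTest.add {φ ψ : ℝ → ℂ} (h : IsTest φ) (k : IsTest ψ) : IsTest (φ + ψ) where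
  smooth := h.smooth.add k.smooth
  compact := h.compact.add k.compact
  supp := (tsupport_add φ ψ).trans (union_subset h.supp k.supp)

lemma IsTest.smul {φ : ℝ → ℂ} (a : ℂ) (h : IsTest φ) : IsTest (a • φ) where
  smooth := h.smooth.const_smul a
  compact := h.compact.smul_left (f := fun _ => a)
  supp := (closure_mono (Function.support_const_smul_subset a φ)).trans h.supp

lemma isTest_zero : IsTest 0 where
  smooth := contDiff_const
  compact := HasCompactSupport.zero
  supp := by simp [tsupport]

lemma IsTest.differentiable {φ : ℝ → ℂ} (h : IsTest φ) : Differentiable ℝ φ :=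
  h.smooth.differentiable (by simp)

lemma IsTest.continuous_deriv {φ : ℝ → ℂ} (h : IsTest φ) : Continuous (deriv φ) :=
  h.smooth.continuous_deriv (by simp)

lemma IsTest.memLp {φ : ℝ → ℂ} (h : IsTest φ) : MemLp φ 2 mu :=
  (h.smooth.continuous.memLp_of_hasCompactSupport h.compact).restrict _

lemma IsTest.memLp_deriv {φ : ℝ → ℂ} (h : IsTest φ) : MemLp (deriv φ) 2 mu :=
  (h.continuous_deriv.memLp_of_hasCompactSupport h.compact.deriv).restrict _

/-- The pairs `(φ, φ')` in `L²(0,1) × L²(0,1)`, where `φ` is a test function. -/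
def testGraph : Submodule ℂ (L2 × L2) where
  carrier := {p | ∃ φ : ℝ → ℂ, IsTest φ ∧ p.1 =ᵐ[mu] φ ∧ p.2 =ᵐ[mu] deriv φ}
  zero_mem' := ⟨0, isTest_zero, Lp.coeFn_zero _ _ _, by
    have : deriv (0 : ℝ → ℂ) = 0 := by ext x; simp
    rw [this]; exact Lp.coeFn_zero _ _ _⟩
  add_mem' := by
    rintro p q ⟨φ, hφ, h1, h2⟩ ⟨ψ, hψ, k1, k2⟩
    refine ⟨φ + ψ, hφ.add hψ, (Lp.coeFn_add _ _).trans (h1.add k1), ?_⟩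
    have : deriv (φ + ψ) = deriv φ + deriv ψ := by
      ext x; exact deriv_add (hφ.differentiable x) (hψ.differentiable x)
    rw [this]; exact (Lp.coeFn_add _ _).trans (h2.add k2)
  smul_mem' := by
    rintro a p ⟨φ, hφ, h1, h2⟩
    refine ⟨a • φ, hφ.smul a, (Lp.coeFn_smul _ _).trans (h1.const_smul a), ?_⟩
    have : deriv (a • φ) = a • deriv φ := by
      ext x; exact deriv_const_smul a (hφ.differentiable x)
    rw [this]; exact (Lp.coeFn_smul _ _).trans (h2.const_smul a)

/-- The space `H¹₀(0,1)`: the closure of the test functions for the `H¹` norm. An element is stored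
together with its weak derivative, so that the closure is taken in `L²(0,1) × L²(0,1)`. -/
def H01 : Type := testGraph.topologicalClosure

instance : AddCommGroup H01 := inferInstanceAs (AddCommGroup testGraph.topologicalClosure)
instance : Module ℂ H01 := inferInstanceAs (Module ℂ testGraph.topologicalClosure)

/-- The inclusion of `H¹₀(0,1)` in `L²(0,1)`. -/
def H01.val : H01 →ₗ[ℂ] L2 :=
  (LinearMap.fst ℂ L2 L2).comp testGraph.topologicalClosure.subtype

/-- The weak derivative `u ↦ u_x` from `H¹₀(0,1)` to `L²(0,1)`. -/
def H01.dx : H01 →ₗ[ℂ] L2 :=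
  (LinearMap.snd ℂ L2 L2).comp testGraph.topologicalClosure.subtype

lemma H01.ext {u w : H01} (h1 : u.val = w.val) (h2 : u.dx = w.dx) : u = w :=
  Subtype.ext (Prod.ext h1 h2)

lemma poincare_test {φ : ℝ → ℂ} (h : IsTest φ) :
    eLpNorm φ 2 mu ≤ eLpNorm (deriv φ) 2 mu := by
  have : IsProbabilityMeasure mu := ⟨by simp⟩
  have key : ∀ x ∈ Ioo (0 : ℝ) 1, ‖φ x‖ₑ ≤ eLpNorm (deriv φ) 1 mu := by
    intro x hx
    have h0 : φ 0 = 0 := by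
      by_contra hne
      exact lt_irrefl _ (h.supp (subset_tsupport _ hne)).1
    have hi : ∫ t in (0 : ℝ)..x, deriv φ t = φ x := by
      rw [intervalIntegral.integral_deriv_eq_sub (fun t _ => h.differentiable t)
        (h.continuous_deriv.intervalIntegrable _ _), h0, sub_zero]
    rw [← hi, intervalIntegral.integral_of_le hx.1.le, eLpNorm_one_eq_lintegral_enorm]
    refine (enorm_integral_le_lintegral_enorm _).trans (lintegral_mono' ?_ le_rfl)
    exact Measure.restrict_mono (Ioc_subset_Ioo_right hx.2) le_rfl
  calc eLpNorm φ 2 mu ≤ eLpNorm φ ⊤ mu :=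
        eLpNorm_le_eLpNorm_of_exponent_le le_top h.memLp.1
    _ ≤ eLpNorm (deriv φ) 1 mu := by
        rw [eLpNorm_exponent_top]
        exact essSup_le_of_ae_le _ ((ae_restrict_iff' measurableSet_Ioo).2 (ae_of_all _ key))
    _ ≤ eLpNorm (deriv φ) 2 mu :=
        eLpNorm_le_eLpNorm_of_exponent_le (by norm_num) h.memLp_deriv.1

/-- Poincaré's inequality on `H¹₀(0,1)`. -/
lemma H01.norm_val_le (u : H01) : ‖u.val‖ ≤ ‖u.dx‖ := by
  have hc : IsClosed {p : L2 × L2 | ‖p.1‖ ≤ ‖p.2‖} :=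
    isClosed_le continuous_fst.norm continuous_snd.norm
  have hsub : (testGraph : Set (L2 × L2)) ⊆ {p : L2 × L2 | ‖p.1‖ ≤ ‖p.2‖} := by
    rintro p ⟨φ, hφ, h1, h2⟩
    simp only [mem_ofPred_eq, Lp.norm_def]
    rw [eLpNorm_congr_ae h1, eLpNorm_congr_ae h2]
    exact ENNReal.toReal_mono hφ.memLp_deriv.2.ne (poincare_test hφ)
  exact closure_minimal hsub hc u.2

lemma H01.dx_injective : Function.Injective H01.dx := by
  intro u w h
  refine H01.ext ?_ h
  have := H01.norm_val_le (u - w)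
  rw [map_sub, map_sub, h, sub_self, norm_zero] at this
  exact sub_eq_zero.1 (norm_le_zero_iff.1 this)

/-- `H¹₀(0,1)` carries the norm `‖u_x‖_{L²}`. -/
instance : NormedAddCommGroup H01 :=
  NormedAddCommGroup.induced H01 L2 H01.dx H01.dx_injective

/-- The inner product of `H¹₀(0,1)` is that of the derivatives in `L²(0,1)`. -/
instance : InnerProductSpace ℂ H01 where
  norm_smul_le a u := by
    change ‖H01.dx (a • u)‖ ≤ ‖a‖ * ‖H01.dx u‖
    rw [map_smul, norm_smul]
  inner u w := inner ℂ u.dx w.dx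
  norm_sq_eq_re_inner u := norm_sq_eq_re_inner (𝕜 := ℂ) u.dx
  conj_inner_symm u w := inner_conj_symm u.dx w.dx
  add_left u w r := by
    change inner ℂ (H01.dx (u + w)) _ = _
    rw [map_add, inner_add_left]
  smul_left u w a := by
    change inner ℂ (H01.dx (a • u)) _ = _
    rw [map_smul, inner_smul_left]

instance : CompleteSpace H01 := by
  let f : H01 → L2 × L2 := fun u => (u.val, u.dx)
  have hd : ∀ u w : H01, dist u w = ‖H01.dx (u - w)‖ := fun u w => dist_eq_norm u w
  have hf : Isometry f := Isometry.of_dist_eq fun u w => by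
    rw [hd, dist_eq_norm, Prod.norm_def]
    change max ‖u.val - w.val‖ ‖u.dx - w.dx‖ = _
    rw [← map_sub, ← map_sub]
    exact max_eq_right (H01.norm_val_le _)
  have hr : Set.range f = testGraph.topologicalClosure := Subtype.range_coe
  refine hf.isUniformInducing.completeSpace ?_
  rw [hr]
  exact testGraph.isClosed_topologicalClosure.isComplete

lemma continuous_integral_mul {ψ : ℝ → ℂ} (h : MemLp ψ 2 mu) :
    Continuous (fun g : L2 => ∫ x, g x * ψ x ∂mu) := by
  have : (fun g : L2 => ∫ x, g x * ψ x ∂mu) = fun g : L2 => inner ℂ (h.star.toLp _) g := by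
    ext g
    rw [L2.inner_def]
    refine integral_congr_ae ?_
    filter_upwards [h.star.coeFn_toLp] with x hx
    simp [hx]
  rw [this]
  fun_prop

/-- The second component of an element of `H¹₀(0,1)` is indeed the weak derivative of the first. -/
lemma H01.isWeakDeriv (u : H01) : IsWeakDeriv u.val u.dx := by
  intro φ hφ
  have hc : IsClosed {p : L2 × L2 | ∫ x, p.1 x * deriv φ x ∂mu = -∫ x, p.2 x * φ x ∂mu} :=
    isClosed_eq ((continuous_integral_mul hφ.memLp_deriv).comp continuous_fst)
      ((continuous_integral_mul hφ.memLp).comp continuous_snd).neg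
  refine closure_minimal ?_ hc u.2
  rintro p ⟨ψ, hψ, h1, h2⟩
  have e1 : ∫ x, p.1 x * deriv φ x ∂mu = ∫ x, ψ x * deriv φ x := by
    refine (integral_congr_ae (h1.mul (ae_eq_refl (deriv φ)))).trans ?_
    refine setIntegral_eq_integral_of_forall_compl_eq_zero fun x hx => ?_
    rw [Pi.mul_apply, image_eq_zero_of_notMem_tsupport fun hm => hx (hψ.supp hm), zero_mul]
  have e2 : ∫ x, p.2 x * φ x ∂mu = ∫ x, deriv ψ x * φ x := by
    refine (integral_congr_ae (h2.mul (ae_eq_refl φ))).trans ?_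
    refine setIntegral_eq_integral_of_forall_compl_eq_zero fun x hx => ?_
    rw [Pi.mul_apply, image_eq_zero_of_notMem_tsupport fun hm => hx (hφ.supp hm), mul_zero]
  simp only [mem_ofPred_eq]
  rw [e1, e2]
  refine integral_mul_deriv_eq_deriv_mul_of_integrable
    (fun x _ => (hψ.differentiable x).hasDerivAt) (fun x _ => (hφ.differentiable x).hasDerivAt)
    ?_ ?_ ?_
  · exact (hψ.smooth.continuous.mul hφ.continuous_deriv).integrable_of_hasCompactSupport
      (hψ.compact.mul_right)
  · exact (hψ.continuous_deriv.mul hφ.smooth.continuous).integrable_of_hasCompactSupport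
      (hφ.compact.mul_left)
  · exact (hψ.smooth.continuous.mul hφ.smooth.continuous).integrable_of_hasCompactSupport
      (hψ.compact.mul_right)

/-- The weak derivative of zero is zero. -/
lemma eq_zero_of_isWeakDeriv {f : ℝ → ℂ} (hf : f =ᵐ[mu] 0) {g : L2} (h : IsWeakDeriv f g) :
    g = 0 := by
  have hl : LocallyIntegrableOn (g : ℝ → ℂ) (Ioo (0 : ℝ) 1) volume := by
    have : IntegrableOn (g : ℝ → ℂ) (Ioo (0 : ℝ) 1) volume := (Lp.memLp g).integrable (by norm_num)
    exact this.locallyIntegrableOn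
  have key := isOpen_Ioo.ae_eq_zero_of_integral_contDiff_smul_eq_zero hl (by
    intro φ hφ hc hs
    have ht : IsTest (fun x => (φ x : ℂ)) :=
      { smooth := Complex.ofRealCLM.contDiff.comp hφ
        compact := hc.comp_left (g := fun r : ℝ => (r : ℂ)) (by simp)
        supp := (tsupport_comp_subset (g := fun r : ℝ => (r : ℂ)) (by simp) φ).trans hs }
    have h3 := h _ ht
    rw [integral_congr_ae (g := fun _ => (0 : ℂ)) (hf.mono fun x hx => by simp [hx])] at h3
    rw [integral_zero, eq_comm, neg_eq_zero] at h3
    rw [← setIntegral_eq_integral_of_forall_compl_eq_zero (s := Ioo (0 : ℝ) 1), ← h3]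
    · refine integral_congr_ae (ae_of_all _ fun x => ?_)
      simp [mul_comm]
    · intro x hx
      rw [image_eq_zero_of_notMem_tsupport fun hm => hx (hs hm), zero_smul])
  refine (Lp.eq_zero_iff_ae_eq_zero).2 ?_
  exact (ae_restrict_iff' measurableSet_Ioo).2 key

lemma H01.val_injective : Function.Injective H01.val := by
  refine (injective_iff_map_eq_zero _).2 fun u hu => H01.dx_injective ?_
  rw [map_zero]
  refine eq_zero_of_isWeakDeriv ?_ u.isWeakDeriv
  rw [hu]
  exact Lp.coeFn_zero _ _ _

/-! ### The energy space and the wave operator -/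

/-- The energy space `(H¹₀(0,1) × L²(0,1))²`, with states `U = ((u, v), (y, z))` and the Hilbert
space structure whose norm satisfies `‖U‖² = ‖u_x‖² + ‖v‖² + ‖y_x‖² + ‖z‖²`. -/
abbrev EnergySpace : Type := WithLp 2 (WithLp 2 (H01 × L2) × WithLp 2 (H01 × L2))

namespace EnergySpace

/-- The displacement `u` of the first wave. -/
def u (U : EnergySpace) : H01 := U.fst.fst

/-- The velocity `v` of the first wave. -/
def v (U : EnergySpace) : L2 := U.fst.snd

/-- The displacement `y` of the second wave. -/
def y (U : EnergySpace) : H01 := U.snd.fst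

/-- The velocity `z` of the second wave. -/
def z (U : EnergySpace) : L2 := U.snd.snd

end EnergySpace

/-- The damping coefficient: `1` on `(1/2, 1]` and `0` elsewhere. -/
def damping : ℝ → ℂ := indicator (Ioc (1 / 2) 1) 1

lemma damping_bound (x : ℝ) : ‖damping x‖ ≤ 1 := by
  unfold damping
  exact (norm_indicator_le_norm_self _ _).trans (by simp)

lemma damping_measurable : Measurable damping :=
  measurable_one.indicator measurableSet_Ioc

lemma IsWeakDeriv.add {f f' g g' : ℝ → ℂ} (hf : MemLp f 2 mu) (hf' : MemLp f' 2 mu)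
    (hg : MemLp g 2 mu) (hg' : MemLp g' 2 mu) (h : IsWeakDeriv f g) (h' : IsWeakDeriv f' g') :
    IsWeakDeriv (fun x => f x + f' x) (fun x => g x + g' x) := by
  intro φ hφ
  have i1 : Integrable (fun x => f x * deriv φ x) mu := hf.integrable_mul hφ.memLp_deriv
  have i2 : Integrable (fun x => f' x * deriv φ x) mu := hf'.integrable_mul hφ.memLp_deriv
  have i3 : Integrable (fun x => g x * φ x) mu := hg.integrable_mul hφ.memLp
  have i4 : Integrable (fun x => g' x * φ x) mu := hg'.integrable_mul hφ.memLp
  simp only [add_mul]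
  rw [integral_add i1 i2, integral_add i3 i4, h φ hφ, h' φ hφ]
  ring

lemma IsWeakDeriv.smul {f g : ℝ → ℂ} (a : ℂ) (h : IsWeakDeriv f g) :
    IsWeakDeriv (fun x => a * f x) (fun x => a * g x) := by
  intro φ hφ
  simp only [mul_assoc]
  rw [integral_const_mul, integral_const_mul, h φ hφ]
  ring

lemma IsWeakDeriv.congr {f f' g g' : ℝ → ℂ} (hf : f =ᵐ[mu] f') (hg : g =ᵐ[mu] g')
    (h : IsWeakDeriv f g) : IsWeakDeriv f' g' := by
  intro φ hφ
  have e1 : ∫ x, f x * deriv φ x ∂mu = ∫ x, f' x * deriv φ x ∂mu :=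
    integral_congr_ae (hf.mul (ae_eq_refl (deriv φ)))
  have e2 : ∫ x, g x * φ x ∂mu = ∫ x, g' x * φ x ∂mu := integral_congr_ae (hg.mul (ae_eq_refl φ))
  rw [← e1, ← e2, h φ hφ]

lemma memLp_stress (p q : L2) : MemLp (fun x => p x + damping x * q x) 2 mu := by
  refine (Lp.memLp p).add ((Lp.memLp q).of_le_mul (c := 1)
    (damping_measurable.aestronglyMeasurable.mul (Lp.memLp q).1) (ae_of_all _ fun x => ?_))
  rw [norm_mul]
  exact mul_le_mul_of_nonneg_right (damping_bound x) (norm_nonneg _)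

lemma memLp_coupled (p q : L2) (c : ℂ) : MemLp (fun x => p x + c * q x) 2 mu :=
  (Lp.memLp p).add ((Lp.memLp q).const_mul c)

/-- `IsWaveImage c U F` says that `U = (u, v, y, z)` lies in the domain of the wave operator, that
is `v, z ∈ H¹₀`, `(u_x + b v_x)_x ∈ L²` and `y ∈ H²`, and that
`F = (v, (u_x + b v_x)_x - c z, z, y_xx + c v)`. Note that `F.u` is `v`, seen in `H¹₀`, once the
first equation holds, and `F.y` is `z`. -/
structure IsWaveImage (c : ℝ) (U F : EnergySpace) : Prop where
  first : F.u.val = U.v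
  second : IsWeakDeriv (fun x => U.u.dx x + damping x * F.u.dx x) (fun x => F.v x + c * U.z x)
  third : F.y.val = U.z
  fourth : IsWeakDeriv U.y.dx (fun x => F.z x + (-c) * U.v x)

/-- The graph of the wave operator. -/
def waveGraph (c : ℝ) : Submodule ℂ (EnergySpace × EnergySpace) where
  carrier := {p | IsWaveImage c p.1 p.2}
  zero_mem' := by
    have h0 : (((0 : L2) : ℝ → ℂ)) =ᵐ[mu] 0 := Lp.coeFn_zero _ _ _
    have hz : IsWeakDeriv (fun _ => 0) (fun _ => 0) := fun φ _ => by simp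
    refine ⟨?_, hz.congr ?_ ?_, ?_, hz.congr ?_ ?_⟩
    · exact map_zero H01.val
    · change _ =ᵐ[mu] fun x => (H01.dx 0 : L2) x + damping x * (H01.dx 0 : L2) x
      rw [map_zero]
      filter_upwards [h0] with x hx
      simp only [hx, Pi.zero_apply, mul_zero, add_zero]
    · change _ =ᵐ[mu] fun x => (0 : L2) x + c * (0 : L2) x
      filter_upwards [h0] with x hx
      simp only [hx, Pi.zero_apply, mul_zero, add_zero]
    · exact map_zero H01.val
    · change _ =ᵐ[mu] ((H01.dx 0 : L2) : ℝ → ℂ)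
      rw [map_zero]
      exact h0.symm
    · change _ =ᵐ[mu] fun x => (0 : L2) x + (-c) * (0 : L2) x
      filter_upwards [h0] with x hx
      simp only [hx, Pi.zero_apply, mul_zero, add_zero]
  add_mem' := by
    rintro ⟨U, F⟩ ⟨U', F'⟩ h h'
    refine ⟨?_, ?_, ?_, ?_⟩
    · change H01.val (F.u + F'.u) = U.v + U'.v
      rw [map_add, h.first, h'.first]
    · refine (IsWeakDeriv.add (memLp_stress _ _) (memLp_stress _ _) (memLp_coupled _ _ _)
        (memLp_coupled _ _ _) h.second h'.second).congr ?_ ?_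
      · change _ =ᵐ[mu] fun x => (H01.dx (U.u + U'.u)) x + damping x * (H01.dx (F.u + F'.u)) x
        rw [map_add, map_add]
        filter_upwards [Lp.coeFn_add U.u.dx U'.u.dx, Lp.coeFn_add F.u.dx F'.u.dx] with x h1 h2
        rw [h1, h2]
        simp only [Pi.add_apply]
        ring
      · change _ =ᵐ[mu] fun x => (F.v + F'.v : L2) x + c * (U.z + U'.z : L2) x
        filter_upwards [Lp.coeFn_add F.v F'.v, Lp.coeFn_add U.z U'.z] with x h1 h2
        rw [h1, h2]
        simp only [Pi.add_apply]
        ring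
    · change H01.val (F.y + F'.y) = U.z + U'.z
      rw [map_add, h.third, h'.third]
    · refine (IsWeakDeriv.add (Lp.memLp _) (Lp.memLp _) (memLp_coupled _ _ _)
        (memLp_coupled _ _ _) h.fourth h'.fourth).congr ?_ ?_
      · change _ =ᵐ[mu] ((H01.dx (U.y + U'.y) : L2) : ℝ → ℂ)
        rw [map_add]
        exact (Lp.coeFn_add _ _).symm
      · change _ =ᵐ[mu] fun x => (F.z + F'.z : L2) x + (-c) * (U.v + U'.v : L2) x
        filter_upwards [Lp.coeFn_add F.z F'.z, Lp.coeFn_add U.v U'.v] with x h1 h2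
        rw [h1, h2]
        simp only [Pi.add_apply]
        ring
  smul_mem' := by
    rintro a ⟨U, F⟩ h
    refine ⟨?_, (h.second.smul a).congr ?_ ?_, ?_, (h.fourth.smul a).congr ?_ ?_⟩
    · change H01.val (a • F.u) = a • U.v
      rw [map_smul, h.first]
    · change _ =ᵐ[mu] fun x => (H01.dx (a • U.u)) x + damping x * (H01.dx (a • F.u)) x
      rw [map_smul, map_smul]
      filter_upwards [Lp.coeFn_smul a U.u.dx, Lp.coeFn_smul a F.u.dx] with x h1 h2
      rw [h1, h2]
      simp only [Pi.smul_apply, smul_eq_mul]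
      ring
    · change _ =ᵐ[mu] fun x => (a • F.v : L2) x + c * (a • U.z : L2) x
      filter_upwards [Lp.coeFn_smul a F.v, Lp.coeFn_smul a U.z] with x h1 h2
      rw [h1, h2]
      simp only [Pi.smul_apply, smul_eq_mul]
      ring
    · change H01.val (a • F.y) = a • U.z
      rw [map_smul, h.third]
    · change _ =ᵐ[mu] ((H01.dx (a • U.y) : L2) : ℝ → ℂ)
      rw [map_smul]
      exact (Lp.coeFn_smul a U.y.dx).symm
    · change _ =ᵐ[mu] fun x => (a • F.z : L2) x + (-c) * (a • U.v : L2) x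
      filter_upwards [Lp.coeFn_smul a F.z, Lp.coeFn_smul a U.v] with x h1 h2
      rw [h1, h2]
      simp only [Pi.smul_apply, smul_eq_mul]
      ring

/-- The graph is single valued. -/
lemma waveGraph_functional (c : ℝ) (p : EnergySpace × EnergySpace) (hp : p ∈ waveGraph c)
    (h0 : p.1 = 0) : p.2 = 0 := by
  obtain ⟨U, F⟩ := p
  change U = 0 at h0
  subst h0
  have h : IsWaveImage c 0 F := hp
  have z0 : (((0 : L2) : ℝ → ℂ)) =ᵐ[mu] 0 := Lp.coeFn_zero _ _ _
  have hu : F.u = 0 := H01.val_injective (h.first.trans (map_zero H01.val).symm)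
  have hy : F.y = 0 := H01.val_injective (h.third.trans (map_zero H01.val).symm)
  have hv : F.v = 0 := by
    refine eq_zero_of_isWeakDeriv ?_ (h.second.congr (ae_eq_refl _) ?_)
    · rw [hu]
      change (fun x => (H01.dx 0 : L2) x + damping x * (H01.dx 0 : L2) x) =ᵐ[mu] 0
      rw [map_zero]
      filter_upwards [z0] with x hx
      simp only [hx, Pi.zero_apply, mul_zero, add_zero]
    · change (fun x => F.v x + c * (0 : L2) x) =ᵐ[mu] _
      filter_upwards [z0] with x hx
      simp only [hx, Pi.zero_apply, mul_zero, add_zero]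
  have hz : F.z = 0 := by
    refine eq_zero_of_isWeakDeriv ?_ (h.fourth.congr (ae_eq_refl _) ?_)
    · change ((H01.dx 0 : L2) : ℝ → ℂ) =ᵐ[mu] 0
      rw [map_zero]
      exact z0
    · change (fun x => F.z x + (-c) * (0 : L2) x) =ᵐ[mu] _
      filter_upwards [z0] with x hx
      simp only [hx, Pi.zero_apply, mul_zero, add_zero]
  have e1 : F.fst = 0 := WithLp.ofLp_injective 2 (Prod.ext hu hv)
  have e2 : F.snd = 0 := WithLp.ofLp_injective 2 (Prod.ext hy hz)
  exact WithLp.ofLp_injective 2 (Prod.ext e1 e2)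

/-- The unbounded wave operator `A(u, v, y, z) = (v, (u_x + b v_x)_x - c z, z, y_xx + c v)`. -/
def waveOperator (c : ℝ) : EnergySpace →ₗ.[ℂ] EnergySpace := (waveGraph c).toLinearPMap

/-- Membership in the domain, and the value of the operator, are given by `IsWaveImage`. -/
lemma mem_graph_waveOperator (c : ℝ) (U F : EnergySpace) :
    (U, F) ∈ (waveOperator c).graph ↔ IsWaveImage c U F := by
  rw [waveOperator, Submodule.toLinearPMap_graph_eq _ fun p hp h => waveGraph_functional c p hp h]
  rfl

/-! ### Semigroups of operators -/

section Semigroup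

variable {E : Type*} [NormedAddCommGroup E] [NormedSpace ℂ E]

/-- Strongly continuous one-parameter semigroups of bounded operators. -/
structure IsC0Semigroup (T : ℝ≥0 → E →L[ℂ] E) : Prop where
  map_zero : T 0 = ContinuousLinearMap.id ℂ E
  map_add : ∀ s t, T (s + t) = (T s).comp (T t)
  tendsto_zero : ∀ x, Tendsto (fun t => T t x) (𝓝 0) (𝓝 x)

/-- `A` is the infinitesimal generator of `T`: the vector `x` lies in the domain of `A` with
`A x = y` if and only if `(T t x - x) / t` converges to `y` as `t → 0+`. -/
def IsGenerator (A : E →ₗ.[ℂ] E) (T : ℝ≥0 → E →L[ℂ] E) : Prop :=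
  ∀ x y : E, (x, y) ∈ A.graph ↔
    Tendsto (fun t : ℝ≥0 => (((t : ℝ) : ℂ)⁻¹) • (T t x - x)) (𝓝[>] 0) (𝓝 y)

/-- Exponential stability: `‖T t x‖ ≤ M exp (-ε t) ‖x‖` for some `M, ε > 0`, all `t > 0`, all `x`. -/
def IsExpStable (T : ℝ≥0 → E →L[ℂ] E) : Prop :=
  ∃ M ε : ℝ, 0 < M ∧ 0 < ε ∧ ∀ t : ℝ≥0, 0 < t → ∀ x : E,
    ‖T t x‖ ≤ M * Real.exp (-ε * t) * ‖x‖

/-- `l` is an eigenvalue of the unbounded operator `A`. -/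
def IsEigenvalue (A : E →ₗ.[ℂ] E) (l : ℂ) : Prop :=
  ∃ x : A.domain, (x : E) ≠ 0 ∧ A x = l • (x : E)

end Semigroup

end KelvinVoigt

end

noncomputable section

namespace KelvinVoigt

/-! ### Generation of contraction semigroups by maximal dissipative operators -/

section Generation

variable {E : Type*} [NormedAddCommGroup E] [InnerProductSpace ℂ E]

/-! Generation is the Lumer–Phillips theorem, proved for Hilbert spaces through Yosida
approximations (`IsMaxDissipative.exists_semigroup`). Testing the equations with the velocities
gives `Re ⟪AU, U⟫ = -∫ b |v_x|²`, because `c` enters skew-symmetrically. The operator `l - A` is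
onto because eliminating `u` and `y` leaves a coercive variational problem in `(v, z)`
(`isMaxDissipative_waveOperator`).

The semigroup multiplies an eigenvector by `exp (l t)`, so exponential stability would force `Re l ≤
-ε` for every eigenvalue (`IsExpStable.exists_re_le`). The two remaining claims therefore follow
from eigenvalues arbitrarily far out and arbitrarily close to the imaginary axis
(`exists_isEigenvalue`).

To find them, solve the eigenvalue equation by exponentials on each half. On the undamped half `u +
iy` and `u - iy` decouple, with exponents `l - ic/2 + o(1)` and `l + ic/2 + o(1)`. On the damped
half one mode is essentially a `y`-wave with exponent `l + o(1)`; the other is essentially carried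
by `u`, with exponent of order `√l` whose real part tends to infinity: a thin boundary layer. The
transmission conditions at `1/2` give a 4×4 determinant whose zeros are eigenvalues
(`isEigenvalue_of_det_eq_zero`).

When `l` goes to infinity with `l - 4πik` convergent, the suitably scaled matrix converges. In the
limit `u` is clamped at `1/2` while `y` passes freely. At `πi + z` the limiting determinant is `sinh
(z/2) (4 sinh² (z/2) + 3 + cos (c/2))` (`limitMatrix_det`), which has an isolated zero at `z = 0`,
on the imaginary axis. Hurwitz's theorem (`eventually_exists_zero`) carries this zero to the true
determinant near `πi + 4πni` for all large `n`. The asymptotics are stated along an arbitrary filter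
(`IsHighFreq`): taken along `atTop ×ˢ 𝓝 z`, they are the locally uniform convergence that Hurwitz's
theorem needs. -/

lemma _root_.HasDerivAt.clm_eval {F : ℝ → E →L[ℂ] E} {F' : E →L[ℂ] E} {t : ℝ}
    (h : HasDerivAt F F' t) (x : E) : HasDerivAt (fun s => F s x) (F' x) t :=
  (((ContinuousLinearMap.apply ℂ E x).restrictScalars ℝ).hasFDerivAt (x := F t)).comp_hasDerivAt t h

/-- The orbit `t ↦ exp (t B) x` of a bounded operator solves the linear differential equation. -/
lemma hasDerivAt_exp_smul_apply [CompleteSpace E] (B : E →L[ℂ] E) (x : E) (t : ℝ) :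
    HasDerivAt (fun s : ℝ => NormedSpace.exp (s • B) x) (NormedSpace.exp (t • B) (B x)) t :=
  (hasDerivAt_exp_smul_const (𝕂 := ℝ) B t).clm_eval x

lemma hasDerivAt_exp_smul_apply' [CompleteSpace E] (B : E →L[ℂ] E) (x : E) (t : ℝ) :
    HasDerivAt (fun s : ℝ => NormedSpace.exp (s • B) x) (B (NormedSpace.exp (t • B) x)) t :=
  (hasDerivAt_exp_smul_const' (𝕂 := ℝ) B t).clm_eval x

/-- The derivative of `‖exp (sB) x‖²` is `2 Re ⟪B ·, ·⟫` along the orbit, hence nonpositive. -/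
lemma norm_exp_apply_le [CompleteSpace E] {B : E →L[ℂ] E}
    (hB : ∀ x, (inner ℂ (B x) x).re ≤ 0) {t : ℝ} (ht : 0 ≤ t) (x : E) :
    ‖NormedSpace.exp (t • B) x‖ ≤ ‖x‖ := by
  have hd : ∀ s : ℝ, HasDerivAt (fun s : ℝ => ‖NormedSpace.exp (s • B) x‖ ^ 2)
      (2 * (inner ℂ (B (NormedSpace.exp (s • B) x)) (NormedSpace.exp (s • B) x)).re) s := by
    intro s
    have h := hasDerivAt_exp_smul_apply' B x s
    have h2 := Complex.reCLM.hasFDerivAt.comp_hasDerivAt s (h.inner ℂ h)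
    refine (h2.congr_deriv ?_).congr_of_eventuallyEq (Eventually.of_forall fun r => ?_)
    · rw [← inner_conj_symm, Complex.reCLM_apply, Complex.add_re, Complex.conj_re]
      ring
    · exact norm_sq_eq_re_inner (𝕜 := ℂ) _
  have hanti : Antitone (fun s : ℝ => ‖NormedSpace.exp (s • B) x‖ ^ 2) := by
    refine antitone_of_deriv_nonpos (fun s => (hd s).differentiableAt) fun s => ?_
    rw [(hd s).deriv]
    have := hB (NormedSpace.exp (s • B) x)
    linarith
  have h := hanti ht
  simp only [zero_smul, NormedSpace.exp_zero, one_apply_eq_self] at h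
  exact le_of_sq_le_sq h (norm_nonneg _)

/-- Duhamel: differentiate `s ↦ exp ((t - s) C) exp (s B) x`, which joins the two exponentials.
Commutation moves `B - C` next to `x`, and both exponentials are contractions. -/
lemma norm_exp_sub_exp_le [CompleteSpace E] {B C : E →L[ℂ] E} (hBC : Commute B C)
    (hB : ∀ x, (inner ℂ (B x) x).re ≤ 0) (hC : ∀ x, (inner ℂ (C x) x).re ≤ 0)
    {t : ℝ} (ht : 0 ≤ t) (x : E) :
    ‖NormedSpace.exp (t • B) x - NormedSpace.exp (t • C) x‖ ≤ t * ‖B x - C x‖ := by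
  have hd : ∀ s ∈ Icc 0 t, HasDerivWithinAt
      (fun s : ℝ => (NormedSpace.exp ((t - s) • C) * NormedSpace.exp (s • B)) x)
      (NormedSpace.exp ((t - s) • C) (NormedSpace.exp (s • B) (B x - C x))) (Icc 0 t) s := by
    intro s _
    have h1 : HasDerivAt (fun r : ℝ => NormedSpace.exp ((t - r) • C))
        (-(NormedSpace.exp ((t - s) • C) * C)) s := by
      have := (hasDerivAt_exp_smul_const (𝕂 := ℝ) C (t - s)).scomp s
        ((hasDerivAt_id s).const_sub t)
      simpa using! this
    have h2 := (h1.mul (hasDerivAt_exp_smul_const (𝕂 := ℝ) B s)).clm_eval x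
    refine (h2.congr_deriv ?_).hasDerivWithinAt
    have hc : C (NormedSpace.exp (s • B) x) = NormedSpace.exp (s • B) (C x) := by
      have : Commute C (NormedSpace.exp (s • B)) := (hBC.symm.smul_right s).exp_right
      exact congrArg (fun T : E →L[ℂ] E => T x) this.eq
    change -(NormedSpace.exp ((t - s) • C) (C (NormedSpace.exp (s • B) x))) +
      NormedSpace.exp ((t - s) • C) (NormedSpace.exp (s • B) (B x)) = _
    rw [hc, map_sub, map_sub]
    abel
  have key := norm_image_sub_le_of_norm_deriv_le_segment' (C := ‖B x - C x‖) hd (fun s hs =>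
    (norm_exp_apply_le hC (sub_nonneg.2 hs.2.le) _).trans (norm_exp_apply_le hB hs.1 _))
    t (right_mem_Icc.2 ht)
  simpa [mul_comm] using key

lemma norm_exp_sub_le [CompleteSpace E] {B : E →L[ℂ] E}
    (hB : ∀ x, (inner ℂ (B x) x).re ≤ 0) {t : ℝ} (ht : 0 ≤ t) (x : E) :
    ‖NormedSpace.exp (t • B) x - x‖ ≤ t * ‖B x‖ := by
  have h := norm_exp_sub_exp_le (Commute.zero_right B) hB (by simp) ht x
  simpa using h

lemma norm_exp_sub_sub_le [CompleteSpace E] {B : E →L[ℂ] E} {t K : ℝ} (ht : 0 ≤ t) (x : E)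
    (hK : ∀ s ∈ Ico 0 t, ‖NormedSpace.exp (s • B) (B x) - B x‖ ≤ K) :
    ‖NormedSpace.exp (t • B) x - x - t • B x‖ ≤ K * t := by
  have hd : ∀ s ∈ Icc 0 t, HasDerivWithinAt
      (fun s : ℝ => NormedSpace.exp (s • B) x - s • B x)
      (NormedSpace.exp (s • B) (B x) - B x) (Icc 0 t) s := by
    intro s _
    have := (hasDerivAt_exp_smul_apply B x s).sub ((hasDerivAt_id s).smul_const (B x))
    simpa using! this.hasDerivWithinAt
  have key := norm_image_sub_le_of_norm_deriv_le_segment' hd hK t (right_mem_Icc.2 ht)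
  simpa [sub_right_comm] using key

/-- An operator is maximal dissipative if `Re ⟪A x, x⟫ ≤ 0` on its domain, and if `l - A` is onto
for every `l > 0`. -/
structure IsMaxDissipative (A : E →ₗ.[ℂ] E) : Prop where
  dissipative : ∀ x y : E, (x, y) ∈ A.graph → (inner ℂ y x).re ≤ 0
  surjective : ∀ l : ℝ, 0 < l → ∀ f : E, ∃ x y : E, (x, y) ∈ A.graph ∧ (l : ℂ) • x - y = f

/-! ### Resolvents, Yosida approximation and Lumer–Phillips -/

namespace IsMaxDissipative

variable {A : E →ₗ.[ℂ] E}

lemma norm_le (hA : IsMaxDissipative A) {l : ℝ} {x y : E}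
    (h : (x, y) ∈ A.graph) : l * ‖x‖ ≤ ‖(l : ℂ) • x - y‖ := by
  have h1 := hA.dissipative x y h
  have h2 : (inner ℂ ((l : ℂ) • x - y) x).re = l * ‖x‖ ^ 2 - (inner ℂ y x).re := by
    rw [inner_sub_left, inner_smul_left, inner_self_eq_norm_sq_to_K, Complex.conj_ofReal,
      Complex.sub_re, Complex.re_ofReal_mul]
    norm_cast
  have h3 : (inner ℂ ((l : ℂ) • x - y) x).re ≤ ‖(l : ℂ) • x - y‖ * ‖x‖ :=
    (Complex.re_le_norm _).trans (norm_inner_le_norm _ _)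
  rcases (norm_nonneg x).eq_or_lt with h0 | h0
  · rw [← h0, mul_zero]; exact norm_nonneg _
  · nlinarith

lemma unique (hA : IsMaxDissipative A) {l : ℝ} (hl : 0 < l) {x y x' y' : E}
    (h : (x, y) ∈ A.graph) (h' : (x', y') ∈ A.graph)
    (he : (l : ℂ) • x - y = (l : ℂ) • x' - y') : x = x' := by
  have hs := A.graph.sub_mem h h'
  have hn := hA.norm_le (l := l) hs
  have : (l : ℂ) • (x - x') - (y - y') = 0 := by
    rw [smul_sub, sub_sub_sub_comm, he, sub_self]
  simp only at hn
  rw [this, norm_zero] at hn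
  have : ‖x - x'‖ = 0 := le_antisymm (nonpos_of_mul_nonpos_right hn hl) (norm_nonneg _)
  exact sub_eq_zero.1 (norm_eq_zero.1 this)

/-- The contraction `l (l - A)⁻¹`. -/
lemma exists_contraction (hA : IsMaxDissipative A) {l : ℝ} (hl : 0 < l) :
    ∃ J : E →L[ℂ] E, (∀ f, ‖J f‖ ≤ ‖f‖) ∧ ∀ f, (J f, (l : ℂ) • (J f - f)) ∈ A.graph := by
  have hex : ∀ f : E, ∃ x : E, (x, (l : ℂ) • (x - f)) ∈ A.graph := by
    intro f
    obtain ⟨x, y, hxy, he⟩ := hA.surjective l hl ((l : ℂ) • f)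
    refine ⟨x, ?_⟩
    rwa [smul_sub, ← he, sub_sub_cancel]
  choose J hJ using hex
  -- Uniqueness makes the chosen solution map linear, since the graph is a subspace.
  have huniq : ∀ x f : E, (x, (l : ℂ) • (x - f)) ∈ A.graph → x = J f := fun x f hx =>
    hA.unique hl hx (hJ f) (by rw [smul_sub, smul_sub]; abel)
  refine ⟨LinearMap.mkContinuous
    { toFun := J, map_add' := fun f g => ?_, map_smul' := fun a f => ?_ } 1 fun f => ?_,
    fun f => ?_, hJ⟩
  · refine (huniq _ _ ?_).symm
    convert A.graph.add_mem (hJ f) (hJ g) using 1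
    ext
    · rfl
    · simp only [Prod.snd_add]; module
  · refine (huniq _ _ ?_).symm
    convert A.graph.smul_mem a (hJ f) using 1
    ext
    · rfl
    · simp only [Prod.smul_snd, RingHom.id_apply]; module
  all_goals
    have h := hA.norm_le (l := l) (hJ f)
    rw [smul_sub, sub_sub_cancel, norm_smul, Complex.norm_real, Real.norm_of_nonneg hl.le] at h
    have := le_of_mul_le_mul_left h hl
    simpa using this

/-- On the domain the Yosida approximation `l (J - 1)` equals `J A`. This follows from `J (x - l⁻¹
y) = x`, which is the resolvent equation for `x`. -/
lemma contraction_graph (hA : IsMaxDissipative A) {l : ℝ} (hl : 0 < l) {J : E →L[ℂ] E}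
    (hJ : ∀ f, (J f, (l : ℂ) • (J f - f)) ∈ A.graph) {x y : E} (h : (x, y) ∈ A.graph) :
    (l : ℂ) • (J x - x) = J y := by
  have hl' : (l : ℂ) ≠ 0 := by exact_mod_cast hl.ne'
  have h1 : J (x - (l : ℂ)⁻¹ • y) = x := by
    refine hA.unique hl (hJ _) h ?_
    rw [smul_sub, smul_sub, smul_inv_smul₀ hl']
    abel
  rw [map_sub, map_smul] at h1
  nth_rewrite 2 [← h1]
  rw [sub_sub_cancel, smul_inv_smul₀ hl']

/-- By `contraction_graph`, `K` commutes with `A` on the domain, so `K (J f)` solves the resolvent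
equation that characterises `J (K f)`. -/
lemma contraction_commute (hA : IsMaxDissipative A) {l m : ℝ} (hl : 0 < l) (hm : 0 < m)
    {J K : E →L[ℂ] E} (hJ : ∀ f, (J f, (l : ℂ) • (J f - f)) ∈ A.graph)
    (hK : ∀ f, (K f, (m : ℂ) • (K f - f)) ∈ A.graph) : Commute J K := by
  ext f
  change J (K f) = K (J f)
  refine hA.unique hl (hJ _) (y' := (l : ℂ) • (K (J f) - K f)) ?_ ?_
  · have h := hK (J f)
    rwa [hA.contraction_graph hm hK (hJ f), map_smul, map_sub] at h
  · rw [smul_sub, smul_sub]; abel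

/-- If `f = x - A x` is orthogonal to the domain, pairing with `x` gives `‖x‖² = ⟪A x, x⟫`, whose
real part is nonpositive; hence `x = 0` and `f = 0`. -/
lemma dense_domain [CompleteSpace E] (hA : IsMaxDissipative A) : Dense (A.domain : Set E) := by
  rw [Submodule.dense_iff_topologicalClosure_eq_top, Submodule.topologicalClosure_eq_top_iff,
    eq_bot_iff]
  intro f hf
  obtain ⟨x, y, hxy, he⟩ := hA.surjective 1 one_pos f
  have hx : x ∈ A.domain := LinearPMap.mem_domain_of_mem_graph hxy
  have h0 := Submodule.inner_left_of_mem_orthogonal hx hf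
  have hd := hA.dissipative x y hxy
  rw [Complex.ofReal_one, one_smul] at he
  rw [← he, inner_sub_left, inner_self_eq_norm_sq_to_K, sub_eq_zero] at h0
  rw [← h0] at hd
  have hx0 : x = 0 := by
    have : ‖x‖ ^ 2 ≤ 0 := by exact_mod_cast hd
    exact norm_eq_zero.1 (pow_eq_zero_iff two_ne_zero |>.1 (le_antisymm this (sq_nonneg _)))
  have hy0 : y = 0 := A.graph_fst_eq_zero_snd hxy hx0
  rw [Submodule.mem_bot, ← he, hx0, hy0, sub_zero]

lemma yosida_dissipative {l : ℝ} (hl : 0 < l) {J : E →L[ℂ] E} (hJ : ∀ f, ‖J f‖ ≤ ‖f‖) (x : E) :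
    (inner ℂ (((l : ℂ) • (J - 1)) x) x).re ≤ 0 := by
  have h1 : (inner ℂ (J x) x).re ≤ ‖x‖ ^ 2 :=
    (Complex.re_le_norm _).trans ((norm_inner_le_norm _ _).trans (by
      nlinarith [hJ x, norm_nonneg x]))
  have h2 : inner ℂ (((l : ℂ) • (J - 1)) x) x = (l : ℂ) * (inner ℂ (J x) x - (‖x‖ : ℂ) ^ 2) := by
    change inner ℂ ((l : ℂ) • (J x - x)) x = _
    rw [inner_smul_left, inner_sub_left, inner_self_eq_norm_sq_to_K, Complex.conj_ofReal]
    rfl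
  rw [h2, Complex.re_ofReal_mul, Complex.sub_re]
  have h3 : ((‖x‖ : ℂ) ^ 2).re = ‖x‖ ^ 2 := by norm_cast
  rw [h3]
  nlinarith

/-- The Yosida approximation of a maximal dissipative operator. -/
lemma exists_yosida [CompleteSpace E] (hA : IsMaxDissipative A) :
    ∃ B : ℕ → E →L[ℂ] E, (∀ n m, Commute (B n) (B m)) ∧
      (∀ n x, (inner ℂ (B n x) x).re ≤ 0) ∧
      ∀ x y, (x, y) ∈ A.graph → (∀ n, ‖B n x‖ ≤ ‖y‖) ∧ Tendsto (fun n => B n x) atTop (𝓝 y) := by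
  have hpos : ∀ n : ℕ, (0 : ℝ) < n + 1 := fun n => by positivity
  choose J hJ1 hJ2 using fun n : ℕ => hA.exists_contraction (hpos n)
  refine ⟨fun n => (((n : ℝ) + 1 : ℝ) : ℂ) • (J n - 1), fun n m => ?_, fun n x => ?_, ?_⟩
  · have := hA.contraction_commute (hpos n) (hpos m) (hJ2 n) (hJ2 m)
    exact (((this.sub_left (Commute.one_left _)).sub_right (Commute.one_right _)).smul_left _
      ).smul_right _
  · exact yosida_dissipative (hpos n) (hJ1 n) x
  · intro x y hxy
    have hB : ∀ n : ℕ, ((((n : ℝ) + 1 : ℝ) : ℂ) • (J n - 1)) x = J n y := fun n =>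
      hA.contraction_graph (hpos n) (hJ2 n) hxy
    simp only [hB]
    refine ⟨fun n => hJ1 n y, ?_⟩
    -- On the domain `J n x - x = J n y / (n + 1)` tends to zero. Density and the uniform bound on
    -- `J n` extend this to every vector, in particular to `y = A x`.
    have hdom : ∀ x ∈ A.domain, Tendsto (fun n => J n x) atTop (𝓝 x) := by
      intro x hx
      obtain ⟨y, hy⟩ := LinearPMap.mem_domain_iff.1 hx
      rw [tendsto_iff_norm_sub_tendsto_zero]
      have hle : ∀ n : ℕ, ‖J n x - x‖ ≤ ‖y‖ * (1 / ((n : ℝ) + 1)) := by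
        intro n
        have h := hA.contraction_graph (hpos n) (hJ2 n) hy
        have h2 := hJ1 n y
        rw [← h, norm_smul, Complex.norm_real, Real.norm_of_nonneg (hpos n).le] at h2
        rw [mul_one_div, le_div_iff₀ (hpos n)]
        linarith
      refine squeeze_zero (fun n => norm_nonneg _) hle ?_
      simpa using tendsto_one_div_add_atTop_nhds_zero_nat.const_mul ‖y‖
    refine Metric.tendsto_atTop.2 fun ε hε => ?_
    obtain ⟨x', hx', hd⟩ := Metric.dense_iff.1 hA.dense_domain y (ε / 3) (by positivity)
    obtain ⟨N, hN⟩ := Metric.tendsto_atTop.1 (hdom x' hd) (ε / 3) (by positivity)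
    refine ⟨N, fun n hn => ?_⟩
    have h1 : dist (J n y) (J n x') ≤ dist x' y := by
      rw [dist_eq_norm, ← map_sub, dist_comm, dist_eq_norm]
      exact hJ1 n _
    have h2 := hN n hn
    rw [Metric.mem_ball] at hx'
    linarith [dist_triangle4 (J n y) (J n x') x' y]

/-- The exponentials of the Yosida approximations converge. -/
lemma exists_limit [CompleteSpace E] (hA : IsMaxDissipative A) {B : ℕ → E →L[ℂ] E}
    (hc : ∀ n m, Commute (B n) (B m)) (hd : ∀ n x, (inner ℂ (B n x) x).re ≤ 0)
    (hB : ∀ x y, (x, y) ∈ A.graph → Tendsto (fun n => B n x) atTop (𝓝 y)) (t : ℝ≥0) (x : E) :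
    ∃ y, Tendsto (fun n => NormedSpace.exp ((t : ℝ) • B n) x) atTop (𝓝 y) := by
  refine cauchySeq_tendsto_of_complete (Metric.cauchySeq_iff'.2 fun ε hε => ?_)
  obtain ⟨x', hx', hx'd⟩ := Metric.dense_iff.1 hA.dense_domain x (ε / 3) (by positivity)
  obtain ⟨y', hy'⟩ := LinearPMap.mem_domain_iff.1 hx'd
  -- On the domain the Duhamel estimate reduces the Cauchy property of the exponentials to that of
  -- `t B n x'`; the contraction bound then passes it to `x`.
  have h0 : Tendsto (fun n => (t : ℝ) • B n x') atTop (𝓝 ((t : ℝ) • y')) :=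
    (hB x' y' hy').const_smul _
  obtain ⟨N, hN⟩ := Metric.cauchySeq_iff'.1 h0.cauchySeq (ε / 3) (by positivity)
  refine ⟨N, fun n hn => ?_⟩
  have h1 : ∀ n, dist (NormedSpace.exp ((t : ℝ) • B n) x) (NormedSpace.exp ((t : ℝ) • B n) x') ≤
      dist x' x := fun n => by
    rw [dist_eq_norm, ← map_sub, dist_comm, dist_eq_norm]
    exact norm_exp_apply_le (hd n) t.2 _
  have h2 : dist (NormedSpace.exp ((t : ℝ) • B n) x') (NormedSpace.exp ((t : ℝ) • B N) x') ≤
      dist ((t : ℝ) • B n x') ((t : ℝ) • B N x') := by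
    rw [dist_smul₀, Real.norm_of_nonneg t.coe_nonneg, dist_eq_norm, dist_eq_norm]
    exact norm_exp_sub_exp_le (hc n N) (hd n) (hd N) t.2 x'
  have h3 := hN n hn
  have h4 := h1 N
  rw [dist_comm] at h4
  rw [Metric.mem_ball] at hx'
  linarith [h1 n, dist_triangle4 (NormedSpace.exp ((t : ℝ) • B n) x)
    (NormedSpace.exp ((t : ℝ) • B n) x') (NormedSpace.exp ((t : ℝ) • B N) x')
    (NormedSpace.exp ((t : ℝ) • B N) x)]

/-- A contraction semigroup which satisfies the expected first order estimate on the domain of a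
maximal dissipative operator is generated by that operator. -/
lemma isGenerator [CompleteSpace E] (hA : IsMaxDissipative A) {T : ℝ≥0 → E →L[ℂ] E}
    (hT : ∀ t x, ‖T t x‖ ≤ ‖x‖)
    (hT1 : ∀ x y x' y', (x, y) ∈ A.graph → (x', y') ∈ A.graph → ∀ t : ℝ≥0,
      ‖T t x - x - (t : ℝ) • y‖ ≤ (2 * ‖y - x'‖ + t * ‖y'‖) * t) : IsGenerator A T := by
  have hdir : ∀ x y : E, (x, y) ∈ A.graph →
      Tendsto (fun t : ℝ≥0 => (((t : ℝ) : ℂ)⁻¹) • (T t x - x)) (𝓝[>] 0) (𝓝 y) := by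
    intro x y hxy
    rw [Metric.tendsto_nhds]
    intro ε hε
    -- Since `y = A x` need not lie in the domain, it is replaced by a nearby `x'` that does. The
    -- two error terms of `hT1` are then each below `ε / 2`.
    obtain ⟨x', hx', hx'd⟩ := Metric.dense_iff.1 hA.dense_domain y (ε / 4) (by positivity)
    obtain ⟨y', hy'⟩ := LinearPMap.mem_domain_iff.1 hx'd
    have hlim : Tendsto (fun t : ℝ≥0 => (t : ℝ) * ‖y'‖) (𝓝[>] 0) (𝓝 0) := by
      have : Continuous (fun t : ℝ≥0 => (t : ℝ) * ‖y'‖) := by fun_prop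
      have h := this.tendsto 0
      simp only [NNReal.coe_zero, zero_mul] at h
      exact h.mono_left nhdsWithin_le_nhds
    filter_upwards [hlim.eventually (gt_mem_nhds (half_pos hε)), self_mem_nhdsWithin] with t ht ht0
    have ht0' : (0 : ℝ) < t := ht0
    have h1 := hT1 x y x' y' hxy hy' t
    have hne : ((t : ℝ) : ℂ) ≠ 0 := by exact_mod_cast ht0'.ne'
    have h2 : (((t : ℝ) : ℂ)⁻¹) • (T t x - x) - y =
        (((t : ℝ) : ℂ)⁻¹) • (T t x - x - (t : ℝ) • y) := by
      rw [smul_sub _ (T t x - x), ← Complex.coe_smul (t : ℝ) y, inv_smul_smul₀ hne]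
    rw [dist_eq_norm, h2, norm_smul, norm_inv, Complex.norm_real, Real.norm_of_nonneg t.coe_nonneg]
    rw [Metric.mem_ball, dist_eq_norm, norm_sub_rev] at hx'
    refine lt_of_le_of_lt (mul_le_mul_of_nonneg_left h1 (inv_nonneg.2 t.2)) ?_
    rw [inv_mul_eq_div, mul_div_cancel_right₀ _ ht0'.ne']
    linarith
  refine fun x y => ⟨hdir x y, fun h => ?_⟩
  -- The generator of a contraction semigroup is dissipative. As `1 - A` is already onto, the
  -- generator cannot properly extend `A`: below, `w = x - x'` has `T`-derivative `w` at zero, so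
  -- `‖w‖² ≤ 0`.
  have hdiss : ∀ w v : E, Tendsto (fun t : ℝ≥0 => (((t : ℝ) : ℂ)⁻¹) • (T t w - w)) (𝓝[>] 0) (𝓝 v) →
      (inner ℂ v w).re ≤ 0 := by
    intro w v hw
    refine le_of_tendsto (Complex.continuous_re.continuousAt.tendsto.comp
      (hw.inner (𝕜 := ℂ) tendsto_const_nhds)) (Eventually.of_forall fun t => ?_)
    simp only [Function.comp]
    rw [inner_smul_left, inner_sub_left, inner_self_eq_norm_sq_to_K, ← Complex.ofReal_inv,
      Complex.conj_ofReal, Complex.re_ofReal_mul, Complex.sub_re]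
    have h3 : ((‖w‖ : ℂ) ^ 2).re = ‖w‖ ^ 2 := by norm_cast
    have h1 : (inner ℂ (T t w) w).re ≤ ‖w‖ ^ 2 :=
      (Complex.re_le_norm _).trans ((norm_inner_le_norm _ _).trans (by
        nlinarith [hT t w, norm_nonneg w]))
    refine mul_nonpos_of_nonneg_of_nonpos (inv_nonneg.2 t.2) ?_
    change (inner ℂ (T t w) w).re - ((‖w‖ : ℂ) ^ 2).re ≤ 0
    rw [h3]
    linarith
  obtain ⟨x', y', hxy', he⟩ := hA.surjective 1 one_pos (x - y)
  rw [Complex.ofReal_one, one_smul] at he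
  have hsub : Tendsto (fun t : ℝ≥0 => (((t : ℝ) : ℂ)⁻¹) • (T t (x - x') - (x - x'))) (𝓝[>] 0)
      (𝓝 (y - y')) := by
    refine (h.sub (hdir x' y' hxy')).congr fun t => ?_
    rw [← smul_sub, map_sub]
    congr 1
    abel
  have h5 := hdiss _ _ hsub
  have h6 : y - y' = x - x' := by
    have : x - y - (x' - y') = 0 := by rw [he, sub_self]
    rw [← sub_eq_zero, ← neg_eq_zero, ← this]
    abel
  rw [h6, inner_self_eq_norm_sq_to_K] at h5
  have h7 : ‖x - x'‖ ^ 2 ≤ 0 := by exact_mod_cast h5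
  have h8 : x - x' = 0 :=
    norm_eq_zero.1 (pow_eq_zero_iff two_ne_zero |>.1 (le_antisymm h7 (sq_nonneg _)))
  rw [h8] at h6
  rwa [sub_eq_zero.1 h8, sub_eq_zero.1 h6]

/-- The Lumer–Phillips theorem in Hilbert spaces: a maximal dissipative operator generates a
strongly continuous semigroup of contractions. -/
theorem exists_semigroup [CompleteSpace E] (hA : IsMaxDissipative A) :
    ∃ T : ℝ≥0 → E →L[ℂ] E, IsC0Semigroup T ∧ (∀ t, ‖T t‖ ≤ 1) ∧ IsGenerator A T := by
  obtain ⟨B, hc, hd, hB⟩ := hA.exists_yosida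
  choose T₀ hT₀ using hA.exists_limit hc hd fun x y h => (hB x y h).2
  have hT : ∀ t, ∃ T : E →L[ℂ] E, ∀ x, T x = T₀ t x := fun t =>
    ⟨continuousLinearMapOfTendsto (fun n => NormedSpace.exp ((t : ℝ) • B n))
      (tendsto_pi_nhds.2 (hT₀ t)), fun x => rfl⟩
  choose T hT using hT
  have hlim : ∀ (t : ℝ≥0) x, Tendsto (fun n => NormedSpace.exp ((t : ℝ) • B n) x) atTop
      (𝓝 (T t x)) := fun t x => by rw [hT]; exact hT₀ t x
  have hle : ∀ t x, ‖T t x‖ ≤ ‖x‖ := fun t x =>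
    le_of_tendsto (hlim t x).norm (Eventually.of_forall fun n => norm_exp_apply_le (hd n) t.2 x)
  have hone : ∀ x y, (x, y) ∈ A.graph → ∀ t : ℝ≥0, ‖T t x - x‖ ≤ t * ‖y‖ := fun x y h t =>
    le_of_tendsto ((hlim t x).sub_const x).norm (Eventually.of_forall fun n =>
      (norm_exp_sub_le (hd n) t.2 x).trans
        (mul_le_mul_of_nonneg_left ((hB x y h).1 n) t.2))
  refine ⟨T, ⟨?_, ?_, ?_⟩, ?_, hA.isGenerator hle ?_⟩
  · ext x
    refine tendsto_nhds_unique (hlim 0 x) ?_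
    simp
  · intro s t
    ext x
    refine tendsto_nhds_unique (hlim (s + t) x) ?_
    have hmul : ∀ n, NormedSpace.exp (((s + t : ℝ≥0) : ℝ) • B n) x =
        NormedSpace.exp ((s : ℝ) • B n) (NormedSpace.exp ((t : ℝ) • B n) x) := by
      intro n
      let +nondep : NormedAlgebra ℚ (E →L[ℂ] E) := .restrictScalars ℚ ℂ _
      rw [NNReal.coe_add, add_smul, NormedSpace.exp_add_of_commute]
      · rfl
      · exact ((Commute.refl (B n)).smul_left _).smul_right _
    simp only [hmul]
    -- The inner argument also depends on `n`; the contraction bound allows it to be replaced by its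
    -- limit `T t x`.
    have h1 : Tendsto (fun n => NormedSpace.exp ((s : ℝ) • B n)
        (NormedSpace.exp ((t : ℝ) • B n) x) - NormedSpace.exp ((s : ℝ) • B n) (T t x)) atTop
        (𝓝 0) := by
      refine squeeze_zero_norm (fun n => ?_) (tendsto_iff_norm_sub_tendsto_zero.1 (hlim t x))
      rw [← map_sub]
      exact norm_exp_apply_le (hd n) s.2 _
    simpa using h1.add (hlim s (T t x))
  · intro x
    refine Metric.tendsto_nhds.2 fun ε hε => ?_
    obtain ⟨x', hx', hx'd⟩ := Metric.dense_iff.1 hA.dense_domain x (ε / 4) (by positivity)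
    obtain ⟨y', hy'⟩ := LinearPMap.mem_domain_iff.1 hx'd
    have hcont : Tendsto (fun t : ℝ≥0 => (t : ℝ) * ‖y'‖) (𝓝 0) (𝓝 0) := by
      have : Continuous (fun t : ℝ≥0 => (t : ℝ) * ‖y'‖) := by fun_prop
      simpa using this.tendsto 0
    filter_upwards [hcont.eventually (gt_mem_nhds (half_pos hε))] with t ht
    have h1 : dist (T t x) (T t x') ≤ dist x' x := by
      rw [dist_eq_norm, ← map_sub, dist_comm, dist_eq_norm]
      exact hle t _
    have h2 := hone x' y' hy' t
    rw [← dist_eq_norm] at h2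
    rw [Metric.mem_ball] at hx'
    linarith [dist_triangle4 (T t x) (T t x') x' x]
  · exact fun t => ContinuousLinearMap.opNorm_le_bound _ zero_le_one fun x => by
      rw [one_mul]; exact hle t x
  · intro x y x' y' hxy hxy' t
    have hb := (hB x y hxy).2
    refine le_of_tendsto_of_tendsto (((hlim t x).sub_const x).sub (hb.const_smul (t : ℝ))).norm
      ((((hb.sub_const x').norm.const_mul 2).add_const ((t : ℝ) * ‖y'‖)).mul_const (t : ℝ))
      (Eventually.of_forall fun n => norm_exp_sub_sub_le t.2 x fun s hs => ?_)
    have h1 : ‖NormedSpace.exp (s • B n) (B n x - x')‖ ≤ ‖B n x - x'‖ :=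
      norm_exp_apply_le (hd n) hs.1 _
    have h2 : ‖NormedSpace.exp (s • B n) x' - x'‖ ≤ t * ‖y'‖ :=
      (norm_exp_sub_le (hd n) hs.1 x').trans
        (mul_le_mul hs.2.le ((hB x' y' hxy').1 n) (norm_nonneg _) t.2)
    -- Splitting through `x'`, an element of the domain near `y`: two terms are at most `‖B n x -
    -- x'‖`, and the middle one is of first order in `s`.
    have h3 : NormedSpace.exp (s • B n) (B n x) - B n x =
        NormedSpace.exp (s • B n) (B n x - x') + (NormedSpace.exp (s • B n) x' - x') -
          (B n x - x') := by
      rw [map_sub]; abel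
    rw [h3]
    refine (norm_sub_le _ _).trans ?_
    linarith [norm_add_le (NormedSpace.exp (s • B n) (B n x - x'))
      (NormedSpace.exp (s • B n) x' - x')]

end IsMaxDissipative

end Generation

/-! ### Eigenvalues and exponential stability -/

section Stability

variable {E : Type*} [NormedAddCommGroup E] [NormedSpace ℂ E]

lemma IsC0Semigroup.continuous_orbit {T : ℝ≥0 → E →L[ℂ] E} (hT : IsC0Semigroup T) {M : ℝ}
    (hM : ∀ t x, ‖T t x‖ ≤ M * ‖x‖) (x : E) : Continuous fun t => T t x := by
  have hle : ∀ s t : ℝ≥0, s ≤ t → dist (T t x) (T s x) ≤ M * ‖T (t - s) x - x‖ := by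
    intro s t hst
    have h1 : T t x = T s (T (t - s) x) := by
      rw [← ContinuousLinearMap.comp_apply, ← hT.map_add, add_tsub_cancel_of_le hst]
    rw [h1, dist_eq_norm, ← map_sub]
    exact hM _ _
  -- With truncated subtraction `t - s + (s - t)` is `|t - s|`, so both one-sided cases are covered
  -- at once.
  have hle' : ∀ s t : ℝ≥0, dist (T t x) (T s x) ≤ M * ‖T (t - s + (s - t)) x - x‖ := by
    intro s t
    rcases le_total s t with h | h
    · rw [tsub_eq_zero_of_le h, add_zero]; exact hle s t h
    · rw [tsub_eq_zero_of_le h, zero_add, dist_comm]; exact hle t s h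
  refine continuous_iff_continuousAt.2 fun s => tendsto_iff_dist_tendsto_zero.2 ?_
  refine squeeze_zero (fun t => dist_nonneg) (hle' s) ?_
  have h1 : Tendsto (fun t : ℝ≥0 => t - s + (s - t)) (𝓝 s) (𝓝 0) := by
    have : Continuous (fun t : ℝ≥0 => t - s + (s - t)) := by fun_prop
    simpa using this.tendsto s
  have h2 := (hT.tendsto_zero x).comp h1
  have h3 := ((h2.sub_const x).norm).const_mul M
  simpa using h3

/-- A semigroup acts on an eigenvector of its generator by the exponential. -/
lemma IsC0Semigroup.apply_eigenvector {T : ℝ≥0 → E →L[ℂ] E} (hT : IsC0Semigroup T) {M : ℝ}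
    (hM : ∀ t x, ‖T t x‖ ≤ M * ‖x‖) {x : E} {l : ℂ}
    (hx : Tendsto (fun t : ℝ≥0 => (((t : ℝ) : ℂ)⁻¹) • (T t x - x)) (𝓝[>] 0) (𝓝 (l • x)))
    (t : ℝ≥0) : x = Complex.exp (-l * (t : ℝ)) • T t x := by
  set g : ℝ → E := fun s => T s.toNNReal x with hg
  have hgc : Continuous g := (hT.continuous_orbit hM x).comp continuous_real_toNNReal
  have hgd : ∀ s : ℝ, 0 ≤ s → HasDerivWithinAt g (l • g s) (Ici s) s := by
    intro s hs
    rw [hasDerivWithinAt_iff_tendsto_slope, Ici_sdiff_left]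
    have h1 : Tendsto (fun r : ℝ => (r - s).toNNReal) (𝓝[>] s) (𝓝[>] 0) := by
      refine tendsto_nhdsWithin_iff.2 ⟨?_, ?_⟩
      · have : Continuous (fun r : ℝ => (r - s).toNNReal) := by fun_prop
        have h := this.tendsto s
        simp only [sub_self, Real.toNNReal_zero] at h
        exact h.mono_left nhdsWithin_le_nhds
      · filter_upwards [self_mem_nhdsWithin] with r hr
        exact Real.toNNReal_pos.2 (sub_pos.2 hr)
    have h2 := ((T s.toNNReal).continuous.tendsto _).comp (hx.comp h1)
    rw [map_smul] at h2
    refine h2.congr' ?_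
    filter_upwards [self_mem_nhdsWithin] with r hr
    have hr' : 0 ≤ r - s := sub_nonneg.2 (le_of_lt hr)
    have h3 : r.toNNReal = s.toNNReal + (r - s).toNNReal := by
      rw [← Real.toNNReal_add hs hr']; congr 1; ring
    simp only [Function.comp, hg, slope_def_module, map_smul, map_sub]
    rw [h3, hT.map_add, Real.coe_toNNReal _ hr', ← Complex.ofReal_inv, Complex.coe_smul]
    rfl
  have hed : ∀ s : ℝ, HasDerivAt (fun s : ℝ => Complex.exp (-l * s))
      (Complex.exp (-l * s) * -l) s := by
    intro s
    have h := ((hasDerivAt_id (s : ℂ)).const_mul (-l)).cexp.comp_ofReal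
    simpa using! h
  -- The orbit has right derivative `l` times itself, so `exp (-l s) T s x` has zero right
  -- derivative. Only right derivatives are available, and with continuity they suffice.
  have key := constant_of_has_deriv_right_zero
    (f := fun s : ℝ => Complex.exp (-l * s) • g s) (a := 0) (b := t)
    (by
      have : Continuous fun s : ℝ => Complex.exp (-l * s) := by fun_prop
      exact (this.smul hgc).continuousOn)
    (fun s hs => by
      have h := (hed s).hasDerivWithinAt.smul (hgd s hs.1)
      refine h.congr_deriv ?_
      module)
    t (right_mem_Icc.2 t.2)
  simp only [hg, Real.toNNReal_coe, Complex.ofReal_zero, mul_zero, Complex.exp_zero, one_smul,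
    Real.toNNReal_zero, hT.map_zero] at key
  exact key.symm

/-- The point spectrum of the generator of an exponentially stable semigroup stays away from the
imaginary axis. -/
theorem IsExpStable.exists_re_le
    {A : E →ₗ.[ℂ] E} {T : ℝ≥0 → E →L[ℂ] E} (hT : IsC0Semigroup T) (hA : IsGenerator A T)
    (hs : IsExpStable T) : ∃ ε : ℝ, 0 < ε ∧ ∀ l, IsEigenvalue A l → l.re ≤ -ε := by
  obtain ⟨M, ε, hM, hε, hbound⟩ := hs
  refine ⟨ε, hε, ?_⟩
  rintro l ⟨x, hx0, hx⟩
  have hgraph : ((x : E), l • (x : E)) ∈ A.graph := by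
    rw [← hx]; exact A.mem_graph x
  have hgen := (hA _ _).1 hgraph
  generalize (x : E) = x at hx0 hgen
  -- The stability bound is only assumed for `t > 0`; the extra `1` covers `T 0 = 1`.
  have hM' : ∀ t x, ‖T t x‖ ≤ (M + 1) * ‖x‖ := by
    intro t x
    rcases eq_zero_or_pos t with rfl | ht
    · rw [hT.map_zero, ContinuousLinearMap.id_apply]
      nlinarith [norm_nonneg x]
    · refine (hbound t ht x).trans (mul_le_mul_of_nonneg_right ?_ (norm_nonneg _))
      have : Real.exp (-ε * t) ≤ 1 := Real.exp_le_one_iff.2 (by nlinarith [t.coe_nonneg])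
      nlinarith
  have hle : ∀ t : ℝ≥0, 0 < t → 1 ≤ M * Real.exp (-((l.re + ε) * t)) := by
    intro t ht
    have h1 := congrArg norm (hT.apply_eigenvector hM' hgen t)
    rw [norm_smul, Complex.norm_exp] at h1
    have h2 := mul_le_mul_of_nonneg_left (hbound t ht x) (Real.exp_pos (-l * (t : ℝ)).re).le
    rw [← h1] at h2
    have h3 : (-l * (t : ℝ)).re = -(l.re * t) := by simp
    have h4 : Real.exp (-((l.re + ε) * t)) = Real.exp (-(l.re * t)) * Real.exp (-ε * t) := by
      rw [← Real.exp_add]; congr 1; ring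
    have hx1 : 0 < ‖x‖ := norm_pos_iff.2 hx0
    rw [h3] at h2
    rw [h4]
    refine le_of_mul_le_mul_right ?_ hx1
    linarith
  -- If `Re l > -ε`, the right side of `hle` tends to zero as `t → ∞`, yet it stays at least `1`.
  by_contra hcon
  have hpos : 0 < l.re + ε := by linarith
  have hlim : Tendsto (fun t : ℝ => M * Real.exp (-((l.re + ε) * t))) atTop (𝓝 0) := by
    have := (Real.tendsto_exp_neg_atTop_nhds_zero.comp
      (tendsto_id.const_mul_atTop hpos)).const_mul M
    simpa using! this
  obtain ⟨t, ht1, ht2⟩ := ((hlim.eventually (gt_mem_nhds one_pos)).and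
    (eventually_gt_atTop 0)).exists
  have := hle ⟨t, ht2.le⟩ ht2
  exact absurd ht1 (not_lt.2 this)

end Stability

/-! ### The wave operator is maximal dissipative -/

lemma IsTest.conj {φ : ℝ → ℂ} (h : IsTest φ) : IsTest (fun x => star (φ x)) where
  smooth := Complex.conjCLE.contDiff.comp h.smooth
  compact := h.compact.comp_left (g := fun w : ℂ => star w) (by simp)
  supp := (tsupport_comp_subset (g := fun w : ℂ => star w) (by simp) φ).trans h.supp

/-- A test function as an element of `H¹₀`. -/
lemma IsTest.exists_H01 {φ : ℝ → ℂ} (h : IsTest φ) :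
    ∃ w : H01, w.val =ᵐ[mu] φ ∧ w.dx =ᵐ[mu] deriv φ :=
  ⟨⟨(h.memLp.toLp, h.memLp_deriv.toLp), testGraph.le_topologicalClosure
    ⟨φ, h, h.memLp.coeFn_toLp, h.memLp_deriv.coeFn_toLp⟩⟩, h.memLp.coeFn_toLp,
    h.memLp_deriv.coeFn_toLp⟩

lemma inner_eq_integral {a b : L2} {f : ℝ → ℂ} (h : a =ᵐ[mu] f) :
    inner ℂ a b = ∫ x, b x * star (f x) ∂mu := by
  rw [L2.inner_def]
  refine integral_congr_ae (h.mono fun x hx => ?_)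
  simp [hx]

/-- A weak derivative can be tested against all of `H¹₀`. -/
lemma isWeakDeriv_iff_forall_inner (F G : L2) :
    IsWeakDeriv F G ↔ ∀ w : H01, inner ℂ w.dx F = -inner ℂ w.val G := by
  constructor
  · intro h w
    have hc : IsClosed {p : L2 × L2 | inner ℂ p.2 F = -inner ℂ p.1 G} :=
      isClosed_eq (by fun_prop) (by fun_prop)
    refine closure_minimal ?_ hc w.2
    rintro p ⟨φ, hφ, h1, h2⟩
    have h3 := h _ hφ.conj
    simp only [deriv.star] at h3
    rw [mem_ofPred_eq, inner_eq_integral h1, inner_eq_integral h2, h3]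
  · intro h φ hφ
    obtain ⟨w, h1, h2⟩ := hφ.conj.exists_H01
    have h3 := h w
    rw [inner_eq_integral h1, inner_eq_integral h2] at h3
    simpa only [deriv.star, star_star] using h3

lemma memLp_damping_mul (g : L2) : MemLp (fun x => damping x * g x) 2 mu :=
  (Lp.memLp g).of_le_mul (c := 1)
    (damping_measurable.aestronglyMeasurable.mul (Lp.memLp g).1) (ae_of_all _ fun x => by
      rw [norm_mul]
      exact mul_le_mul_of_nonneg_right (damping_bound x) (norm_nonneg _))

/-- Multiplication by the damping coefficient. -/
def dampCLM : L2 →L[ℂ] L2 :=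
  LinearMap.mkContinuous
    { toFun := fun g => (memLp_damping_mul g).toLp
      map_add' := fun f g => by
        rw [← MemLp.toLp_add]
        refine MemLp.toLp_congr _ _ ?_
        filter_upwards [Lp.coeFn_add f g] with x hx
        rw [hx, Pi.add_apply, Pi.add_apply, mul_add]
      map_smul' := fun a g => by
        rw [RingHom.id_apply, ← MemLp.toLp_const_smul]
        refine MemLp.toLp_congr _ _ ?_
        filter_upwards [Lp.coeFn_smul a g] with x hx
        rw [hx, Pi.smul_apply, Pi.smul_apply, smul_eq_mul, smul_eq_mul]
        ring } 1 fun g => by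
      refine Lp.norm_le_mul_norm_of_ae_le_mul ?_
      filter_upwards [(memLp_damping_mul g).coeFn_toLp] with x hx
      refine (le_of_eq (congrArg norm hx)).trans ?_
      rw [norm_mul]
      exact mul_le_mul_of_nonneg_right (damping_bound x) (norm_nonneg _)

lemma coeFn_dampCLM (g : L2) : dampCLM g =ᵐ[mu] fun x => damping x * g x :=
  (memLp_damping_mul g).coeFn_toLp

lemma re_inner_dampCLM_nonneg (g : L2) : 0 ≤ (inner ℂ g (dampCLM g)).re := by
  have h := L2.integrable_inner (𝕜 := ℂ) g (dampCLM g)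
  rw [L2.inner_def]
  change 0 ≤ RCLike.re (∫ a, inner ℂ (g a) (dampCLM g a) ∂mu)
  rw [← integral_re h]
  refine integral_nonneg_of_ae ?_
  filter_upwards [coeFn_dampCLM g] with x hx
  rw [hx]
  simp only [Pi.zero_apply, RCLike.inner_apply]
  unfold damping
  by_cases hx' : x ∈ Ioc (1 / 2 : ℝ) 1
  · rw [indicator_of_mem hx', Pi.one_apply, one_mul, Complex.mul_conj]
    exact_mod_cast Complex.normSq_nonneg _
  · rw [indicator_of_notMem hx', zero_mul, zero_mul]
    simp

/-- Variational form of the wave operator. -/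
lemma isWaveImage_iff (c : ℝ) (U F : EnergySpace) : IsWaveImage c U F ↔
    F.u.val = U.v ∧
    (∀ w : H01, inner ℂ w.dx (U.u.dx + dampCLM F.u.dx) = -inner ℂ w.val (F.v + (c : ℂ) • U.z)) ∧
    F.y.val = U.z ∧
    ∀ w : H01, inner ℂ w.dx U.y.dx = -inner ℂ w.val (F.z - (c : ℂ) • U.v) := by
  have e1 : (U.u.dx + dampCLM F.u.dx : L2) =ᵐ[mu] fun x => U.u.dx x + damping x * F.u.dx x := by
    filter_upwards [Lp.coeFn_add U.u.dx (dampCLM F.u.dx), coeFn_dampCLM F.u.dx] with x h1 h2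
    rw [h1, Pi.add_apply, h2]
  have e2 : (F.v + (c : ℂ) • U.z : L2) =ᵐ[mu] fun x => F.v x + c * U.z x := by
    filter_upwards [Lp.coeFn_add F.v ((c : ℂ) • U.z), Lp.coeFn_smul (c : ℂ) U.z] with x h1 h2
    rw [h1, Pi.add_apply, h2, Pi.smul_apply, smul_eq_mul]
  have e3 : (F.z - (c : ℂ) • U.v : L2) =ᵐ[mu] fun x => F.z x + (-c) * U.v x := by
    filter_upwards [Lp.coeFn_sub F.z ((c : ℂ) • U.v), Lp.coeFn_smul (c : ℂ) U.v] with x h1 h2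
    rw [h1, Pi.sub_apply, h2, Pi.smul_apply, smul_eq_mul]
    ring
  rw [← isWeakDeriv_iff_forall_inner, ← isWeakDeriv_iff_forall_inner]
  constructor
  · rintro ⟨h1, h2, h3, h4⟩
    exact ⟨h1, h2.congr e1.symm e2.symm, h3, h4.congr (ae_eq_refl _) e3.symm⟩
  · rintro ⟨h1, h2, h3, h4⟩
    exact ⟨h1, h2.congr e1 e2, h3, h4.congr (ae_eq_refl _) e3⟩

/-- Test the two second-order equations with the velocities `F.u` and `F.y`. The elastic terms
cancel against the `H¹₀` part of the inner product, the coupling terms cancel in real part, and only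
minus the damping term remains. -/
lemma IsWaveImage.re_inner_nonpos {c : ℝ} {U F : EnergySpace} (h : IsWaveImage c U F) :
    (inner ℂ F U).re ≤ 0 := by
  obtain ⟨h1, h2, h3, h4⟩ := (isWaveImage_iff c U F).1 h
  have e : inner ℂ F U = inner ℂ F.u.dx U.u.dx + inner ℂ F.v U.v +
      (inner ℂ F.y.dx U.y.dx + inner ℂ F.z U.z) := rfl
  have k1 := h2 F.u
  have k2 := h4 F.y
  rw [h1, inner_add_right, inner_add_right, inner_smul_right] at k1
  rw [h3, inner_sub_right, inner_smul_right] at k2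
  have hd := re_inner_dampCLM_nonneg F.u.dx
  have r1 := congrArg Complex.re k1
  have r2 := congrArg Complex.re k2
  simp only [Complex.add_re, Complex.neg_re, Complex.sub_re, Complex.re_ofReal_mul] at r1 r2
  have s1 : (inner ℂ F.v U.v).re = (inner ℂ U.v F.v).re := inner_re_symm (𝕜 := ℂ) _ _
  have s2 : (inner ℂ F.z U.z).re = (inner ℂ U.z F.z).re := inner_re_symm (𝕜 := ℂ) _ _
  have s3 : (inner ℂ U.v U.z).re = (inner ℂ U.z U.v).re := inner_re_symm (𝕜 := ℂ) _ _
  rw [e]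
  simp only [Complex.add_re]
  rw [s3] at r1
  linarith

/-- The inclusion of `H¹₀` in `L²` as a bounded operator. -/
def valCLM : H01 →L[ℂ] L2 := H01.val.mkContinuous 1 fun u => by
  rw [one_mul]; exact u.norm_val_le

/-- The derivative from `H¹₀` to `L²` as a bounded operator. -/
def dxCLM : H01 →L[ℂ] L2 := H01.dx.mkContinuous 1 fun u => by
  rw [one_mul]; exact le_refl ‖u.dx‖

/-- The variational problem which has to be solved in order to invert `l - A`. -/
lemma exists_variational_solution (c : ℝ) {l : ℝ} (hl : 0 < l) (f₁ f₃ : H01) (f₂ f₄ : L2) :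
    ∃ v z : H01, ∀ w : H01,
      inner ℂ w.dx ((l : ℂ)⁻¹ • (v.dx + f₁.dx) + dampCLM v.dx) =
        -inner ℂ w.val ((l : ℂ) • v.val - f₂ + (c : ℂ) • z.val) ∧
      inner ℂ w.dx ((l : ℂ)⁻¹ • (z.dx + f₃.dx)) =
        -inner ℂ w.val ((l : ℂ) • z.val - f₄ - (c : ℂ) • v.val) := by
  let P : WithLp 2 (H01 × H01) →L[ℂ] H01 := WithLp.fstL 2 ℂ H01 H01
  let Q : WithLp 2 (H01 × H01) →L[ℂ] H01 := WithLp.sndL 2 ℂ H01 H01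
  let N : H01 →L[ℂ] H01 := valCLM.adjoint ∘L valCLM
  let D : H01 →L[ℂ] H01 := dxCLM.adjoint ∘L dampCLM ∘L dxCLM
  -- The Riesz operator of the sesquilinear form in `(v, z)`. Here `N` represents the `L²` product
  -- and `D` the damping form on `H¹₀`.
  let S : WithLp 2 (H01 × H01) →L[ℂ] WithLp 2 (H01 × H01) :=
    P.adjoint ∘L (((l : ℂ) • N + (l : ℂ)⁻¹ • ContinuousLinearMap.id ℂ H01 + D) ∘L P
      + (c : ℂ) • N ∘L Q) +
    Q.adjoint ∘L (((l : ℂ) • N + (l : ℂ)⁻¹ • ContinuousLinearMap.id ℂ H01) ∘L Q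
      - (c : ℂ) • N ∘L P)
  have hS : ∀ w x : WithLp 2 (H01 × H01), inner ℂ w (S x) =
      (l : ℂ) * inner ℂ w.fst.val x.fst.val + (l : ℂ)⁻¹ * inner ℂ w.fst x.fst +
        inner ℂ w.fst.dx (dampCLM x.fst.dx) + (c : ℂ) * inner ℂ w.fst.val x.snd.val +
      ((l : ℂ) * inner ℂ w.snd.val x.snd.val + (l : ℂ)⁻¹ * inner ℂ w.snd x.snd -
        (c : ℂ) * inner ℂ w.snd.val x.fst.val) := by
    intro w x
    simp only [S, N, D, add_apply, ContinuousLinearMap.comp_apply,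
      sub_apply, smul_apply, inner_add_right,
      inner_sub_right, inner_smul_right, ContinuousLinearMap.adjoint_inner_right,
      ContinuousLinearMap.id_apply]
    rfl
  -- Lax–Milgram. The `c` terms drop out of `Re ⟪x, S x⟫`, the `L²` and damping terms are
  -- nonnegative, and `l⁻¹` times the identity gives the coercivity constant `l⁻¹`.
  have hunit : IsUnit S := by
    refine ContinuousLinearMap.isUnit_of_forall_le_norm_inner_map S
      (c := ⟨l⁻¹, (inv_pos.2 hl).le⟩) (inv_pos.2 hl) fun x => ?_
    rw [norm_inner_symm]
    refine le_trans ?_ (Complex.re_le_norm _)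
    rw [hS]
    have s3 : (inner ℂ x.fst.val x.snd.val).re = (inner ℂ x.snd.val x.fst.val).re :=
      inner_re_symm (𝕜 := ℂ) _ _
    have hd := re_inner_dampCLM_nonneg x.fst.dx
    simp only [Complex.add_re, Complex.sub_re, ← Complex.ofReal_inv, Complex.re_ofReal_mul, s3]
    have p1 : 0 ≤ (inner ℂ x.fst.val x.fst.val).re := inner_self_nonneg (𝕜 := ℂ)
    have p2 : 0 ≤ (inner ℂ x.snd.val x.snd.val).re := inner_self_nonneg (𝕜 := ℂ)
    have n1 : (inner ℂ x.fst x.fst).re = ‖x.fst‖ ^ 2 := (norm_sq_eq_re_inner (𝕜 := ℂ) _).symm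
    have n2 : (inner ℂ x.snd x.snd).re = ‖x.snd‖ ^ 2 := (norm_sq_eq_re_inner (𝕜 := ℂ) _).symm
    rw [WithLp.prod_norm_sq_eq_of_L2, n1, n2]
    change (‖x.fst‖ ^ 2 + ‖x.snd‖ ^ 2) * l⁻¹ ≤ _
    have q1 := mul_nonneg hl.le p1
    have q2 := mul_nonneg hl.le p2
    linarith
  obtain ⟨X, hX⟩ : ∃ X, S X = P.adjoint (valCLM.adjoint f₂ - (l : ℂ)⁻¹ • f₁) +
      Q.adjoint (valCLM.adjoint f₄ - (l : ℂ)⁻¹ • f₃) :=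
    (ContinuousLinearMap.isUnit_iff_bijective.1 hunit).2 _
  have hR : ∀ w : WithLp 2 (H01 × H01), inner ℂ w (S X) =
      inner ℂ w.fst.val f₂ - (l : ℂ)⁻¹ * inner ℂ w.fst f₁ +
      (inner ℂ w.snd.val f₄ - (l : ℂ)⁻¹ * inner ℂ w.snd f₃) := by
    intro w
    rw [hX]
    simp only [inner_add_right, inner_sub_right, inner_smul_right,
      ContinuousLinearMap.adjoint_inner_right]
    rfl
  refine ⟨X.fst, X.snd, fun w => ⟨?_, ?_⟩⟩
  · have h1 := (hS (WithLp.toLp 2 (w, 0)) X).symm.trans (hR (WithLp.toLp 2 (w, 0)))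
    simp only [WithLp.toLp_fst, WithLp.toLp_snd, map_zero, inner_zero_left, mul_zero, add_zero,
      sub_zero] at h1
    change _ + (l : ℂ)⁻¹ * inner ℂ w.dx X.fst.dx + _ + _ =
      _ - (l : ℂ)⁻¹ * inner ℂ w.dx f₁.dx at h1
    simp only [inner_add_right, inner_sub_right, inner_smul_right]
    linear_combination h1
  · have h1 := (hS (WithLp.toLp 2 (0, w)) X).symm.trans (hR (WithLp.toLp 2 (0, w)))
    simp only [WithLp.toLp_fst, WithLp.toLp_snd, map_zero, inner_zero_left, mul_zero, add_zero,
      sub_zero, zero_add] at h1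
    change _ + (l : ℂ)⁻¹ * inner ℂ w.dx X.snd.dx - _ =
      _ - (l : ℂ)⁻¹ * inner ℂ w.dx f₃.dx at h1
    simp only [inner_add_right, inner_sub_right, inner_smul_right]
    linear_combination h1

lemma EnergySpace.ext {U V : EnergySpace} (hu : U.u = V.u) (hv : U.v = V.v) (hy : U.y = V.y)
    (hz : U.z = V.z) : U = V := by
  have e1 : U.fst = V.fst := WithLp.ofLp_injective 2 (Prod.ext hu hv)
  have e2 : U.snd = V.snd := WithLp.ofLp_injective 2 (Prod.ext hy hz)
  exact WithLp.ofLp_injective 2 (Prod.ext e1 e2)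

/-- The state with given components. -/
def EnergySpace.mk (u : H01) (v : L2) (y : H01) (z : L2) : EnergySpace :=
  WithLp.toLp 2 (WithLp.toLp 2 (u, v), WithLp.toLp 2 (y, z))

/-- In `(l - A) U = f` the first and third equations give `u = (v + f.u) / l` and `y = (z + f.y) /
l`. Substituting them leaves exactly the variational problem for `(v, z)`. -/
theorem isMaxDissipative_waveOperator (c : ℝ) : IsMaxDissipative (waveOperator c) where
  dissipative U F h := ((mem_graph_waveOperator c U F).1 h).re_inner_nonpos
  surjective l hl f := by
    obtain ⟨v, z, h⟩ := exists_variational_solution c hl f.u f.y f.v f.z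
    have hl' : (l : ℂ) ≠ 0 := by exact_mod_cast hl.ne'
    refine ⟨.mk ((l : ℂ)⁻¹ • (v + f.u)) v.val ((l : ℂ)⁻¹ • (z + f.y)) z.val,
      .mk v ((l : ℂ) • v.val - f.v) z ((l : ℂ) • z.val - f.z), ?_, ?_⟩
    · rw [mem_graph_waveOperator, isWaveImage_iff]
      refine ⟨rfl, fun w => ?_, rfl, fun w => ?_⟩
      · change inner ℂ w.dx (H01.dx ((l : ℂ)⁻¹ • (v + f.u)) + _) = _
        rw [map_smul, map_add]
        exact (h w).1
      · change inner ℂ w.dx (H01.dx ((l : ℂ)⁻¹ • (z + f.y))) = _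
        rw [map_smul, map_add]
        exact (h w).2
    · refine EnergySpace.ext ?_ ?_ ?_ ?_
      · change (l : ℂ) • ((l : ℂ)⁻¹ • (v + f.u)) - v = f.u
        rw [smul_inv_smul₀ hl', add_sub_cancel_left]
      · exact sub_sub_cancel _ _
      · change (l : ℂ) • ((l : ℂ)⁻¹ • (z + f.y)) - z = f.y
        rw [smul_inv_smul₀ hl', add_sub_cancel_left]
      · exact sub_sub_cancel _ _

/-! ### Piecewise smooth functions in `H¹₀(0,1)` -/

lemma _root_.Continuous.memLp_mu {f : ℝ → ℂ} (hf : Continuous f) : MemLp f 2 mu := by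
  obtain ⟨C, hC⟩ := isCompact_Icc.exists_bound_of_continuousOn (s := Icc (0 : ℝ) 1) hf.continuousOn
  refine MemLp.of_bound hf.aestronglyMeasurable C ?_
  exact (ae_restrict_iff' measurableSet_Ioo).2 (ae_of_all _ fun x hx =>
    hC x (Ioo_subset_Icc_self hx))

lemma integral_mul_congr {f f' : ℝ → ℂ} (h : f =ᵐ[mu] f') (k : ℝ → ℂ) :
    ∫ x, f x * k x ∂mu = ∫ x, f' x * k x ∂mu :=
  integral_congr_ae (h.mul (ae_eq_refl k))

lemma integral_mu_eq (f : ℝ → ℂ) : ∫ x, f x ∂mu = ∫ x in (0 : ℝ)..1, f x := by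
  rw [intervalIntegral.integral_of_le zero_le_one, integral_Ioc_eq_integral_Ioo]

lemma contDiff_primitive {ψ : ℝ → ℂ} (h : ContDiff ℝ ∞ ψ) :
    ContDiff ℝ ∞ (fun x => ∫ t in (0 : ℝ)..x, ψ t) ∧
      deriv (fun x => ∫ t in (0 : ℝ)..x, ψ t) = ψ := by
  have hd : deriv (fun x => ∫ t in (0 : ℝ)..x, ψ t) = ψ := by
    ext x
    exact h.continuous.deriv_integral ψ 0 x
  refine ⟨contDiff_infty_iff_deriv.2 ⟨fun x => ?_, by rwa [hd]⟩, hd⟩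
  exact (intervalIntegral.integral_hasDerivAt_right (h.continuous.intervalIntegrable _ _)
    (h.continuous.stronglyMeasurableAtFilter _ _) h.continuous.continuousAt).differentiableAt

/-- The primitive of a test function of mean zero is a test function. -/
lemma IsTest.primitive {η : ℝ → ℂ} (h : IsTest η) (h0 : ∫ x, η x ∂mu = 0) :
    IsTest (fun x => ∫ t in (0 : ℝ)..x, η t) := by
  obtain ⟨a, b, ha, hb, hab⟩ : ∃ a b : ℝ, 0 < a ∧ b < 1 ∧ tsupport η ⊆ Icc a b := by
    rcases (tsupport η).eq_empty_or_nonempty with he | hne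
    · exact ⟨1 / 2, 1 / 2, by norm_num, by norm_num, by simp [he]⟩
    · obtain ⟨a, ha⟩ := IsCompact.exists_isLeast h.compact hne
      obtain ⟨b, hb⟩ := IsCompact.exists_isGreatest h.compact hne
      exact ⟨a, b, (h.supp ha.1).1, (h.supp hb.1).2, fun x hx => ⟨ha.2 hx, hb.2 hx⟩⟩
  have hz : ∀ t, t ∉ Icc a b → η t = 0 := fun t ht =>
    image_eq_zero_of_notMem_tsupport fun hm => ht (hab hm)
  have hsub : Function.support (fun x => ∫ t in (0 : ℝ)..x, η t) ⊆ Icc a b := by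
    intro x hx
    by_contra hcon
    refine hx ?_
    rcases lt_or_ge x a with hxa | hxa
    · refine intervalIntegral.integral_zero_ae (ae_of_all _ fun t ht => hz t fun hm => ?_)
      exact absurd (hm.1.trans ht.2) (not_le.2 (max_lt ha hxa))
    · have hxb : b < x := by
        by_contra hle
        exact hcon ⟨hxa, not_lt.1 hle⟩
      change ∫ t in (0 : ℝ)..x, η t = 0
      rw [← intervalIntegral.integral_add_adjacent_intervals (b := 1)
        (h.smooth.continuous.intervalIntegrable _ _) (h.smooth.continuous.intervalIntegrable _ _),
        ← integral_mu_eq, h0, zero_add]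
      refine intervalIntegral.integral_zero_ae (ae_of_all _ fun t ht => hz t fun hm => ?_)
      exact absurd (ht.1.trans_le hm.2) (not_lt.2 (le_min hb.le hxb.le))
  have hts : tsupport (fun x => ∫ t in (0 : ℝ)..x, η t) ⊆ Icc a b :=
    closure_minimal hsub isClosed_Icc
  exact
    { smooth := (contDiff_primitive h.smooth).1
      compact := isCompact_Icc.of_isClosed_subset (isClosed_tsupport _) hts
      supp := hts.trans (Icc_subset_Ioo ha hb) }

lemma exists_isTest_integral_eq_one : ∃ ρ : ℝ → ℂ, IsTest ρ ∧ ∫ x, ρ x ∂mu = 1 := by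
  let f : ContDiffBump (1 / 2 : ℝ) := ⟨1 / 8, 1 / 4, by norm_num, by norm_num⟩
  have hs : tsupport (f.normed volume) ⊆ Ioo 0 1 := by
    rw [f.tsupport_normed_eq, Real.closedBall_eq_Icc]
    exact Icc_subset_Ioo (by norm_num) (by norm_num)
  refine ⟨fun x => (f.normed volume x : ℂ),
    { smooth := Complex.ofRealCLM.contDiff.comp f.contDiff_normed
      compact := f.hasCompactSupport_normed.comp_left (g := fun r : ℝ => (r : ℂ)) (by simp)
      supp := (tsupport_comp_subset (g := fun r : ℝ => (r : ℂ)) (by simp) _).trans hs }, ?_⟩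
  rw [setIntegral_eq_integral_of_forall_compl_eq_zero, integral_complex_ofReal, f.integral_normed,
    Complex.ofReal_one]
  intro x hx
  rw [image_eq_zero_of_notMem_tsupport fun hm => hx (hs hm), Complex.ofReal_zero]

lemma eq_zero_of_forall_integral {h : L2} (hh : ∀ φ, IsTest φ → ∫ x, h x * φ x ∂mu = 0) :
    h = 0 :=
  eq_zero_of_isWeakDeriv (f := 0) (ae_eq_refl _) fun φ hφ => by simp [hh φ hφ]

/-- The du Bois-Reymond lemma. -/
lemma exists_eq_const_of_isWeakDeriv_zero {h : L2}
    (hh : ∀ φ, IsTest φ → ∫ x, h x * deriv φ x ∂mu = 0) : ∃ C : ℂ, h =ᵐ[mu] fun _ => C := by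
  obtain ⟨ρ, hρ, hρ1⟩ := exists_isTest_integral_eq_one
  set C := ∫ x, h x * ρ x ∂mu with hC
  have hCm : MemLp (fun _ : ℝ => C) 2 mu := continuous_const.memLp_mu
  refine ⟨C, ?_⟩
  have key : h - hCm.toLp = 0 := by
    refine eq_zero_of_forall_integral fun ψ hψ => ?_
    set m := ∫ x, ψ x ∂mu with hm
    -- Removing the mean `m` of `ψ` makes its primitive a test function, so the hypothesis on `h`
    -- applies to it.
    have hη : IsTest (ψ + (-m) • ρ) := hψ.add (hρ.smul _)
    have iψ : Integrable ψ mu := hψ.memLp.integrable (by norm_num)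
    have iρ : Integrable ρ mu := hρ.memLp.integrable (by norm_num)
    have h0 : ∫ x, (ψ + (-m) • ρ) x ∂mu = 0 := by
      rw [integral_add' iψ (iρ.smul _)]
      simp only [Pi.smul_apply]
      rw [integral_smul, hρ1, ← hm]
      simp
    have h1 := hh _ (hη.primitive h0)
    rw [(contDiff_primitive hη.smooth).2] at h1
    have i1 : Integrable (fun x => h x * ψ x) mu := (Lp.memLp h).integrable_mul hψ.memLp
    have i2 : Integrable (fun x => h x * ρ x) mu := (Lp.memLp h).integrable_mul hρ.memLp
    have e1 : ∫ x, h x * (ψ + (-m) • ρ) x ∂mu =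
        ∫ x, (h x * ψ x - m * (h x * ρ x)) ∂mu := by
      congr 1; ext x; simp only [Pi.add_apply, Pi.smul_apply, smul_eq_mul]; ring
    rw [e1, integral_sub i1 (i2.const_mul m), integral_const_mul, ← hC] at h1
    have e2 : ∫ x, (h - hCm.toLp : L2) x * ψ x ∂mu = ∫ x, (h x * ψ x - C * ψ x) ∂mu := by
      refine integral_congr_ae ?_
      filter_upwards [Lp.coeFn_sub h hCm.toLp, hCm.coeFn_toLp] with x k1 k2
      rw [k1, Pi.sub_apply, k2, sub_mul]
    rw [e2, integral_sub i1 (iψ.const_mul C), integral_const_mul, ← hm, mul_comm C, h1]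
  rw [sub_eq_zero.1 key]
  exact hCm.coeFn_toLp

/-- Elements of `H¹₀` can be integrated by parts against smooth functions, without boundary
terms. -/
lemma H01.integral_mul_deriv (u : H01) {Ψ : ℝ → ℂ} (hΨ : ContDiff ℝ ∞ Ψ) :
    ∫ x, u.val x * deriv Ψ x ∂mu = -∫ x, u.dx x * Ψ x ∂mu := by
  have hΨd : Continuous (deriv Ψ) := hΨ.continuous_deriv (by simp)
  have hc : IsClosed {p : L2 × L2 | ∫ x, p.1 x * deriv Ψ x ∂mu = -∫ x, p.2 x * Ψ x ∂mu} :=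
    isClosed_eq ((continuous_integral_mul hΨd.memLp_mu).comp continuous_fst)
      ((continuous_integral_mul hΨ.continuous.memLp_mu).comp continuous_snd).neg
  refine closure_minimal ?_ hc u.2
  rintro p ⟨ψ, hψ, h1, h2⟩
  have hz : ∀ x, x ∉ Ioo (0 : ℝ) 1 → ψ x = 0 := fun x hx =>
    image_eq_zero_of_notMem_tsupport fun hm => hx (hψ.supp hm)
  rw [mem_ofPred_eq, integral_mul_congr h1, integral_mul_congr h2, integral_mu_eq,
    integral_mu_eq, intervalIntegral.integral_mul_deriv_eq_deriv_mul
    (fun x _ => (hψ.differentiable x).hasDerivAt)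
    (fun x _ => (hΨ.differentiable (by simp) x).hasDerivAt)
    (hψ.continuous_deriv.intervalIntegrable _ _) (hΨd.intervalIntegrable _ _),
    hz 1 (by simp), hz 0 (by simp)]
  ring

/-- Functions which can be integrated by parts without boundary terms are in `H¹₀`. -/
lemma exists_H01_of_integral_mul_deriv {f g : L2} (h : ∀ Ψ : ℝ → ℂ, ContDiff ℝ ∞ Ψ →
    ∫ x, f x * deriv Ψ x ∂mu = -∫ x, g x * Ψ x ∂mu) : ∃ u : H01, u.val = f ∧ u.dx = g := by
  have hiso : Isometry H01.dx := Isometry.of_dist_eq fun u w => by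
    rw [dist_eq_norm, ← map_sub, dist_eq_norm]; rfl
  have hcomplete : IsComplete (LinearMap.range H01.dx : Set L2) := by
    rw [LinearMap.coe_range]
    exact hiso.isUniformInducing.isComplete_range
  have : CompleteSpace (LinearMap.range H01.dx) := hcomplete.completeSpace_coe
  -- The range of `dx` is closed, and a vector orthogonal to it is constant by du Bois-Reymond.
  -- Taking `Ψ = 1` shows that `g` has mean zero, so `g` is orthogonal to constants.
  have hg : g ∈ LinearMap.range H01.dx := by
    rw [← Submodule.orthogonal_orthogonal (LinearMap.range H01.dx)]
    intro k hk
    obtain ⟨C, hC⟩ := exists_eq_const_of_isWeakDeriv_zero (h := k) (by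
      intro φ hφ
      obtain ⟨w, -, hw⟩ := hφ.conj.exists_H01
      have h1 : inner ℂ w.dx k = 0 := hk _ ⟨w, rfl⟩
      rw [inner_eq_integral hw] at h1
      simpa only [deriv.star, star_star] using h1)
    have h1 := h (fun _ => 1) contDiff_const
    simp only [deriv_const, mul_zero, integral_zero, mul_one] at h1
    rw [inner_eq_integral hC, integral_mul_const, neg_eq_zero.1 h1.symm, zero_mul]
  obtain ⟨u, hu⟩ := hg
  refine ⟨u, sub_eq_zero.1 (eq_zero_of_forall_integral fun ψ hψ => ?_), hu⟩
  -- The primitive of `ψ` need not have compact support; this is why integration by parts is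
  -- required against every smooth function.
  obtain ⟨p1, p2⟩ := contDiff_primitive hψ.smooth
  have h1 := h _ p1
  have h2 := u.integral_mul_deriv p1
  rw [hu, ← h1] at h2
  rw [p2] at h2
  have i1 : Integrable (fun x => u.val x * ψ x) mu := (Lp.memLp _).integrable_mul hψ.memLp
  have i2 : Integrable (fun x => f x * ψ x) mu := (Lp.memLp _).integrable_mul hψ.memLp
  have e2 : ∫ x, (u.val - f : L2) x * ψ x ∂mu = ∫ x, (u.val x * ψ x - f x * ψ x) ∂mu := by
    refine integral_congr_ae ?_
    filter_upwards [Lp.coeFn_sub u.val f] with x k1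
    rw [k1, Pi.sub_apply, sub_mul]
  rw [e2, integral_sub i1 i2, h2, sub_self]

/-! ### Gluing classical solutions at the interface -/

/-- The function equal to `a` on the left of `1/2` and to `b` on the right. -/
def glue (a b : ℝ → ℂ) (x : ℝ) : ℂ := if x ≤ 1 / 2 then a x else b x

lemma integral_glue {a b : ℝ → ℂ} (ha : Continuous a) (hb : Continuous b) :
    ∫ x, glue a b x ∂mu = (∫ x in (0 : ℝ)..(1 / 2), a x) + ∫ x in (1 / 2 : ℝ)..1, b x := by
  have e1 : ∀ x ∈ uIoc (0 : ℝ) (1 / 2), a x = glue a b x := by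
    intro x hx
    rw [uIoc_of_le (by norm_num)] at hx
    exact (if_pos hx.2).symm
  have e2 : ∀ x ∈ uIoc (1 / 2 : ℝ) 1, b x = glue a b x := by
    intro x hx
    rw [uIoc_of_le (by norm_num)] at hx
    exact (if_neg (not_le.2 hx.1)).symm
  rw [integral_mu_eq, ← intervalIntegral.integral_add_adjacent_intervals (b := 1 / 2)
    ((intervalIntegrable_congr e1).1 (ha.intervalIntegrable _ _))
    ((intervalIntegrable_congr e2).1 (hb.intervalIntegrable _ _)),
    intervalIntegral.integral_congr_ae (ae_of_all _ e1),
    intervalIntegral.integral_congr_ae (ae_of_all _ e2)]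

lemma memLp_glue {a b : ℝ → ℂ} (ha : Continuous a) (hb : Continuous b) :
    MemLp (glue a b) 2 mu := by
  have e : glue a b = (Iic (1 / 2 : ℝ)).piecewise a b := by
    ext x; simp [glue, Set.piecewise]
  rw [e]
  exact MemLp.piecewise measurableSet_Iic (ha.memLp_mu.restrict _) (hb.memLp_mu.restrict _)

lemma glue_mul (a b k : ℝ → ℂ) (x : ℝ) :
    glue a b x * k x = glue (fun x => a x * k x) (fun x => b x * k x) x := by
  unfold glue; split_ifs <;> rfl

/-- Integration by parts for a glued function. -/
lemma integral_glue_mul_deriv {a a' b b' Ψ : ℝ → ℂ} (ha : ∀ x, HasDerivAt a (a' x) x)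
    (hb : ∀ x, HasDerivAt b (b' x) x) (ha' : Continuous a') (hb' : Continuous b')
    (hab : a (1 / 2) = b (1 / 2)) (hΨ : ContDiff ℝ ∞ Ψ) :
    ∫ x, glue a b x * deriv Ψ x ∂mu =
      b 1 * Ψ 1 - a 0 * Ψ 0 - ∫ x, glue a' b' x * Ψ x ∂mu := by
  have hac : Continuous a := continuous_iff_continuousAt.2 fun x => (ha x).continuousAt
  have hbc : Continuous b := continuous_iff_continuousAt.2 fun x => (hb x).continuousAt
  have hΨd : Continuous (deriv Ψ) := hΨ.continuous_deriv (by simp)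
  have hΨ' : ∀ x, HasDerivAt Ψ (deriv Ψ x) x := fun x =>
    (hΨ.differentiable (by simp) x).hasDerivAt
  simp only [glue_mul]
  rw [integral_glue (a := fun x => a x * deriv Ψ x) (b := fun x => b x * deriv Ψ x)
      (hac.mul hΨd) (hbc.mul hΨd),
    integral_glue (a := fun x => a' x * Ψ x) (b := fun x => b' x * Ψ x)
      (ha'.mul hΨ.continuous) (hb'.mul hΨ.continuous),
    intervalIntegral.integral_mul_deriv_eq_deriv_mul (fun x _ => ha x) (fun x _ => hΨ' x)
      (ha'.intervalIntegrable _ _) (hΨd.intervalIntegrable _ _),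
    intervalIntegral.integral_mul_deriv_eq_deriv_mul (fun x _ => hb x) (fun x _ => hΨ' x)
      (hb'.intervalIntegrable _ _) (hΨd.intervalIntegrable _ _), hab]
  ring

/-- Matching values at `1/2` cancel the interface terms, and the test function kills those at `0`
and `1`. No boundary condition is needed, so this also applies to the flux. -/
lemma isWeakDeriv_glue {a a' b b' : ℝ → ℂ} (ha : ∀ x, HasDerivAt a (a' x) x)
    (hb : ∀ x, HasDerivAt b (b' x) x) (ha' : Continuous a') (hb' : Continuous b')
    (hab : a (1 / 2) = b (1 / 2)) : IsWeakDeriv (glue a b) (glue a' b') := by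
  intro φ hφ
  have hz : ∀ x, x ∉ Ioo (0 : ℝ) 1 → φ x = 0 := fun x hx =>
    image_eq_zero_of_notMem_tsupport fun hm => hx (hφ.supp hm)
  rw [integral_glue_mul_deriv ha hb ha' hb' hab hφ.smooth, hz 1 (by simp), hz 0 (by simp)]
  ring

lemma exists_H01_glue {a a' b b' : ℝ → ℂ} (ha : ∀ x, HasDerivAt a (a' x) x)
    (hb : ∀ x, HasDerivAt b (b' x) x) (ha' : Continuous a') (hb' : Continuous b')
    (hab : a (1 / 2) = b (1 / 2)) (h0 : a 0 = 0) (h1 : b 1 = 0) :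
    ∃ u : H01, u.val =ᵐ[mu] glue a b ∧ u.dx =ᵐ[mu] glue a' b' := by
  have hac : Continuous a := continuous_iff_continuousAt.2 fun x => (ha x).continuousAt
  have hbc : Continuous b := continuous_iff_continuousAt.2 fun x => (hb x).continuousAt
  have m1 := memLp_glue hac hbc
  have m2 := memLp_glue ha' hb'
  obtain ⟨u, hu1, hu2⟩ := exists_H01_of_integral_mul_deriv (f := m1.toLp) (g := m2.toLp) (by
    intro Ψ hΨ
    rw [integral_mul_congr m1.coeFn_toLp, integral_mul_congr m2.coeFn_toLp,
      integral_glue_mul_deriv ha hb ha' hb' hab hΨ, h0, h1]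
    ring)
  exact ⟨u, hu1 ▸ m1.coeFn_toLp, hu2 ▸ m2.coeFn_toLp⟩

/-- Eigenfunctions obtained by gluing classical solutions on both sides of `1/2`. -/
theorem isEigenvalue_of_glue {c : ℝ} {l : ℂ} {u₁ u₂ y₁ y₂ du₁ du₂ dy₁ dy₂ : ℝ → ℂ}
    (hu₁ : ∀ x, HasDerivAt u₁ (du₁ x) x) (hu₂ : ∀ x, HasDerivAt u₂ (du₂ x) x)
    (hy₁ : ∀ x, HasDerivAt y₁ (dy₁ x) x) (hy₂ : ∀ x, HasDerivAt y₂ (dy₂ x) x)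
    (hdu₁ : ∀ x, HasDerivAt du₁ (l ^ 2 * u₁ x + c * l * y₁ x) x)
    (hdu₂ : ∀ x, HasDerivAt (fun x => (1 + l) * du₂ x) (l ^ 2 * u₂ x + c * l * y₂ x) x)
    (hdy₁ : ∀ x, HasDerivAt dy₁ (l ^ 2 * y₁ x - c * l * u₁ x) x)
    (hdy₂ : ∀ x, HasDerivAt dy₂ (l ^ 2 * y₂ x - c * l * u₂ x) x)
    (hdu₂c : Continuous du₂)
    (bu₁ : u₁ 0 = 0) (bu₂ : u₂ 1 = 0) (by₁ : y₁ 0 = 0) (by₂ : y₂ 1 = 0)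
    (tu : u₁ (1 / 2) = u₂ (1 / 2)) (ty : y₁ (1 / 2) = y₂ (1 / 2))
    (tdu : du₁ (1 / 2) = (1 + l) * du₂ (1 / 2)) (tdy : dy₁ (1 / 2) = dy₂ (1 / 2))
    (hne : ∃ x ∈ Ioo (0 : ℝ) (1 / 2), u₁ x ≠ 0 ∨ y₁ x ≠ 0) :
    IsEigenvalue (waveOperator c) l := by
  have cont : ∀ {f f' : ℝ → ℂ}, (∀ x, HasDerivAt f (f' x) x) → Continuous f := fun h =>
    continuous_iff_continuousAt.2 fun x => (h x).continuousAt
  have cu₁ := cont hu₁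
  have cu₂ := cont hu₂
  have cy₁ := cont hy₁
  have cy₂ := cont hy₂
  obtain ⟨u, u0, u1⟩ := exists_H01_glue hu₁ hu₂ (cont hdu₁) hdu₂c tu bu₁ bu₂
  obtain ⟨y, y0, y1⟩ := exists_H01_glue hy₁ hy₂ (cont hdy₁) (cont hdy₂) ty by₁ by₂
  set U : EnergySpace := .mk u (l • u.val) y (l • y.val) with hU
  -- With `v = l u` the flux `u_x + b v_x` is `u_x` on the left and `(1 + l) u_x` on the right; this
  -- glued function is what must be continuous at `1/2`.
  have himage : IsWaveImage c U (l • U) := by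
    have w2 := isWeakDeriv_glue hdu₁ hdu₂ (by fun_prop) (by fun_prop) tdu
    have w4 := isWeakDeriv_glue hdy₁ hdy₂ (by fun_prop) (by fun_prop) tdy
    refine ⟨map_smul _ _ _, w2.congr ?_ ?_, map_smul _ _ _, w4.congr y1.symm ?_⟩
    · have e : (l • U).u.dx =ᵐ[mu] l • (u.dx : ℝ → ℂ) := by
        change (H01.dx (l • u) : L2) =ᵐ[mu] _
        rw [map_smul]
        exact Lp.coeFn_smul _ _
      filter_upwards [e, u1, ae_restrict_mem measurableSet_Ioo] with x h1 h2 hx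
      change _ = u.dx x + damping x * _
      rw [h1, Pi.smul_apply, h2, smul_eq_mul]
      unfold damping glue
      split_ifs with hx2
      · rw [indicator_of_notMem fun hm => absurd hm.1 (not_lt.2 hx2)]
        ring
      · rw [indicator_of_mem (show x ∈ Ioc (1 / 2 : ℝ) 1 from ⟨not_le.1 hx2, hx.2.le⟩),
          Pi.one_apply]
        ring
    · filter_upwards [Lp.coeFn_smul l (l • u.val), Lp.coeFn_smul l u.val, Lp.coeFn_smul l y.val,
        u0, y0] with x h1 h2 h3 h4 h5
      change _ = (l • (l • u.val) : L2) x + c * (l • y.val : L2) x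
      rw [h1, Pi.smul_apply, h2, Pi.smul_apply, h3, Pi.smul_apply, h4, h5]
      simp only [smul_eq_mul]
      unfold glue
      split_ifs <;> ring
    · filter_upwards [Lp.coeFn_smul l (l • y.val), Lp.coeFn_smul l y.val, Lp.coeFn_smul l u.val,
        u0, y0] with x h1 h2 h3 h4 h5
      change _ = (l • (l • y.val) : L2) x + (-c) * (l • u.val : L2) x
      rw [h1, Pi.smul_apply, h2, Pi.smul_apply, h3, Pi.smul_apply, h4, h5]
      simp only [smul_eq_mul]
      unfold glue
      split_ifs <;> ring
  -- A vanishing class only gives zero almost everywhere; continuity of `a` upgrades this to every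
  -- point of the left half.
  have hzero : ∀ {w : H01} {a b : ℝ → ℂ}, Continuous a → w.val =ᵐ[mu] glue a b → w = 0 →
      ∀ x ∈ Ioo (0 : ℝ) (1 / 2), a x = 0 := by
    intro w a b ha hw hw0
    rw [hw0, map_zero] at hw
    have h1 : glue a b =ᵐ[volume.restrict (Ioo (0 : ℝ) (1 / 2))] 0 :=
      ae_restrict_of_ae_restrict_of_subset (Ioo_subset_Ioo_right (by norm_num))
        (hw.symm.trans (Lp.coeFn_zero _ _ _))
    have h2 : a =ᵐ[volume.restrict (Ioo (0 : ℝ) (1 / 2))] fun _ => (0 : ℂ) := by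
      filter_upwards [h1, ae_restrict_mem measurableSet_Ioo] with x hx hxm
      rw [← show glue a b x = a x from if_pos hxm.2.le, hx]
      rfl
    exact Measure.eqOn_open_of_ae_eq h2 isOpen_Ioo ha.continuousOn continuousOn_const
  have hgraph := (mem_graph_waveOperator c U (l • U)).2 himage
  obtain ⟨X, hX, hAX⟩ := (LinearPMap.mem_graph_iff _).1 hgraph
  refine ⟨X, ?_, ?_⟩
  · simp only at hX
    rw [hX]
    intro h0
    obtain ⟨x, hx, h⟩ := hne
    have hu0 : u = 0 := congrArg EnergySpace.u h0
    have hy0 : y = 0 := congrArg EnergySpace.y h0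
    exact h.elim (fun h => h (hzero cu₁ u0 hu0 x hx)) fun h => h (hzero cy₁ y0 hy0 x hx)
  · rw [hX]; exact hAX

/-! ### The characteristic equation -/

/-- If `sinh (m x)` vanished on the whole interval, so would its derivative `m cosh (m x)`, against
`cosh² - sinh² = 1`. -/
lemma exists_sinh_mul_ne_zero {m : ℂ} (hm : m ≠ 0) :
    ∃ x ∈ Ioo (0 : ℝ) (1 / 2), Complex.sinh (m * x) ≠ 0 := by
  by_contra! h
  have h4 : (1 / 4 : ℝ) ∈ Ioo (0 : ℝ) (1 / 2) := by constructor <;> norm_num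
  have hd : HasDerivAt (fun x : ℝ => Complex.sinh (m * x))
      (Complex.cosh (m * (1 / 4 : ℝ)) * m) (1 / 4) := by
    have := (((hasDerivAt_id ((1 / 4 : ℝ) : ℂ)).const_mul m).csinh).comp_ofReal
    simpa using! this
  have h0 : HasDerivAt (fun x : ℝ => Complex.sinh (m * x)) 0 (1 / 4) :=
    (hasDerivAt_const (1 / 4 : ℝ) (0 : ℂ)).congr_of_eventuallyEq
      ((isOpen_Ioo.eventually_mem h4).mono fun x hx => h x hx)
  have h1 := (mul_eq_zero.1 (hd.unique h0)).resolve_right hm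
  have h2 := Complex.cosh_sq_sub_sinh_sq (m * (1 / 4 : ℝ))
  rw [h1, h _ h4] at h2
  norm_num at h2

lemma hasDerivAt_sinh_mul (m : ℂ) (x : ℝ) :
    HasDerivAt (fun x : ℝ => Complex.sinh (m * x)) (m * Complex.cosh (m * x)) x := by
  have := (((hasDerivAt_id (x : ℂ)).const_mul m).csinh).comp_ofReal
  simpa [mul_comm] using! this

lemma hasDerivAt_cosh_mul (m : ℂ) (x : ℝ) :
    HasDerivAt (fun x : ℝ => Complex.cosh (m * x)) (m * Complex.sinh (m * x)) x := by
  have := (((hasDerivAt_id (x : ℂ)).const_mul m).ccosh).comp_ofReal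
  simpa [mul_comm] using! this

lemma hasDerivAt_sinh_mul_one_sub (m : ℂ) (x : ℝ) :
    HasDerivAt (fun x : ℝ => Complex.sinh (m * (1 - x : ℝ)))
      (-m * Complex.cosh (m * (1 - x : ℝ))) x := by
  have := (hasDerivAt_sinh_mul m (1 - x)).scomp x ((hasDerivAt_id x).const_sub 1)
  exact this.congr_deriv (by simp)

lemma hasDerivAt_cosh_mul_one_sub (m : ℂ) (x : ℝ) :
    HasDerivAt (fun x : ℝ => Complex.cosh (m * (1 - x : ℝ)))
      (-m * Complex.sinh (m * (1 - x : ℝ))) x := by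
  have := (hasDerivAt_cosh_mul m (1 - x)).scomp x ((hasDerivAt_id x).const_sub 1)
  exact this.congr_deriv (by simp)

/-- Transmission conditions for a combination of exponential modes on both sides of `1/2`. -/
lemma isEigenvalue_of_modes {c : ℝ} {l m₁ m₂ n₁ n₂ p q a₁ a₂ b₁ b₂ : ℂ}
    (hm₁ : m₁ ^ 2 = l ^ 2 - Complex.I * c * l) (hm₂ : m₂ ^ 2 = l ^ 2 + Complex.I * c * l)
    (hn₁ : n₁ ^ 2 = l ^ 2 - c * l * p) (hn₁' : (1 + l) * (p * n₁ ^ 2) = l ^ 2 * p + c * l)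
    (hn₂ : q * n₂ ^ 2 = l ^ 2 * q - c * l) (hn₂' : (1 + l) * n₂ ^ 2 = l ^ 2 + c * l * q)
    (hm₁0 : m₁ ≠ 0) (hm₂0 : m₂ ≠ 0) (ha : a₁ ≠ 0 ∨ a₂ ≠ 0)
    (tu : a₁ * Complex.sinh (m₁ / 2) + a₂ * Complex.sinh (m₂ / 2) =
      b₁ * p * Complex.sinh (n₁ / 2) + b₂ * Complex.sinh (n₂ / 2))
    (ty : -Complex.I * (a₁ * Complex.sinh (m₁ / 2) - a₂ * Complex.sinh (m₂ / 2)) =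
      b₁ * Complex.sinh (n₁ / 2) + b₂ * q * Complex.sinh (n₂ / 2))
    (tdu : a₁ * m₁ * Complex.cosh (m₁ / 2) + a₂ * m₂ * Complex.cosh (m₂ / 2) =
      -(1 + l) * (b₁ * p * n₁ * Complex.cosh (n₁ / 2) + b₂ * n₂ * Complex.cosh (n₂ / 2)))
    (tdy : -Complex.I * (a₁ * m₁ * Complex.cosh (m₁ / 2) - a₂ * m₂ * Complex.cosh (m₂ / 2)) =
      -(b₁ * n₁ * Complex.cosh (n₁ / 2) + b₂ * q * n₂ * Complex.cosh (n₂ / 2))) :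
    IsEigenvalue (waveOperator c) l := by
  have e1 : ∀ m : ℂ, m * ((1 / 2 : ℝ) : ℂ) = m / 2 := fun m => by push_cast; ring
  have e2 : ∀ m : ℂ, m * ((1 - 1 / 2 : ℝ) : ℂ) = m / 2 := fun m => by push_cast; ring
  have hI : Complex.I * Complex.I = -1 := Complex.I_mul_I
  -- The `sinh` modes vanish at `0` on the left and at `1` on the right. On the left `y = -iu` for
  -- the first mode and `y = iu` for the second; on the right the directions `(u, y)` are `(p, 1)`
  -- and `(1, q)`.
  refine isEigenvalue_of_glue
    (u₁ := fun x => a₁ * Complex.sinh (m₁ * x) + a₂ * Complex.sinh (m₂ * x))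
    (y₁ := fun x => -Complex.I * (a₁ * Complex.sinh (m₁ * x) - a₂ * Complex.sinh (m₂ * x)))
    (u₂ := fun x => b₁ * p * Complex.sinh (n₁ * (1 - x : ℝ)) +
      b₂ * Complex.sinh (n₂ * (1 - x : ℝ)))
    (y₂ := fun x => b₁ * Complex.sinh (n₁ * (1 - x : ℝ)) +
      b₂ * q * Complex.sinh (n₂ * (1 - x : ℝ)))
    (du₁ := fun x => a₁ * (m₁ * Complex.cosh (m₁ * x)) + a₂ * (m₂ * Complex.cosh (m₂ * x)))
    (dy₁ := fun x => -Complex.I *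
      (a₁ * (m₁ * Complex.cosh (m₁ * x)) - a₂ * (m₂ * Complex.cosh (m₂ * x))))
    (du₂ := fun x => b₁ * p * (-n₁ * Complex.cosh (n₁ * (1 - x : ℝ))) +
      b₂ * (-n₂ * Complex.cosh (n₂ * (1 - x : ℝ))))
    (dy₂ := fun x => b₁ * (-n₁ * Complex.cosh (n₁ * (1 - x : ℝ))) +
      b₂ * q * (-n₂ * Complex.cosh (n₂ * (1 - x : ℝ))))
    ?_ ?_ ?_ ?_ ?_ ?_ ?_ ?_ ?_ ?_ ?_ ?_ ?_ ?_ ?_ ?_ ?_ ?_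
  · exact fun x => ((hasDerivAt_sinh_mul m₁ x).const_mul a₁).add
      ((hasDerivAt_sinh_mul m₂ x).const_mul a₂)
  · exact fun x => ((hasDerivAt_sinh_mul_one_sub n₁ x).const_mul (b₁ * p)).add
      ((hasDerivAt_sinh_mul_one_sub n₂ x).const_mul b₂)
  · exact fun x => (((hasDerivAt_sinh_mul m₁ x).const_mul a₁).sub
      ((hasDerivAt_sinh_mul m₂ x).const_mul a₂)).const_mul _
  · exact fun x => ((hasDerivAt_sinh_mul_one_sub n₁ x).const_mul b₁).add
      ((hasDerivAt_sinh_mul_one_sub n₂ x).const_mul (b₂ * q))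
  · intro x
    refine ((((hasDerivAt_cosh_mul m₁ x).const_mul m₁).const_mul a₁).add
      (((hasDerivAt_cosh_mul m₂ x).const_mul m₂).const_mul a₂)).congr_deriv ?_
    linear_combination a₁ * Complex.sinh (m₁ * x) * hm₁ + a₂ * Complex.sinh (m₂ * x) * hm₂
  · intro x
    refine (((((hasDerivAt_cosh_mul_one_sub n₁ x).const_mul (-n₁)).const_mul (b₁ * p)).add
      (((hasDerivAt_cosh_mul_one_sub n₂ x).const_mul (-n₂)).const_mul b₂)).const_mul
        (1 + l)).congr_deriv ?_
    linear_combination b₁ * Complex.sinh (n₁ * (1 - x : ℝ)) * hn₁' +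
      b₂ * Complex.sinh (n₂ * (1 - x : ℝ)) * hn₂'
  · intro x
    refine (((((hasDerivAt_cosh_mul m₁ x).const_mul m₁).const_mul a₁).sub
      (((hasDerivAt_cosh_mul m₂ x).const_mul m₂).const_mul a₂)).const_mul _).congr_deriv ?_
    linear_combination -Complex.I * a₁ * Complex.sinh (m₁ * x) * hm₁ +
      Complex.I * a₂ * Complex.sinh (m₂ * x) * hm₂ + c * l *
      (a₁ * Complex.sinh (m₁ * x) + a₂ * Complex.sinh (m₂ * x)) * hI
  · intro x
    refine ((((hasDerivAt_cosh_mul_one_sub n₁ x).const_mul (-n₁)).const_mul b₁).add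
      (((hasDerivAt_cosh_mul_one_sub n₂ x).const_mul (-n₂)).const_mul (b₂ * q))).congr_deriv ?_
    linear_combination b₁ * Complex.sinh (n₁ * (1 - x : ℝ)) * hn₁ +
      b₂ * Complex.sinh (n₂ * (1 - x : ℝ)) * hn₂
  · fun_prop
  · simp
  · simp
  · simp
  · simp
  · simp only [e1, e2]; exact tu
  · simp only [e1, e2]; exact ty
  · simp only [e1, e2]; linear_combination tdu
  · simp only [e1, e2]; linear_combination tdy
  -- The combination `u₁ + i y₁` equals `2 a₁ sinh (m₁ x)` and `u₁ - i y₁` equals `2 a₂ sinh (m₂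
  -- x)`, so the modes cannot cancel.
  · rcases ha with ha | ha
    · obtain ⟨x, hx, hs⟩ := exists_sinh_mul_ne_zero hm₁0
      refine ⟨x, hx, ?_⟩
      by_contra! h
      refine mul_ne_zero ha hs ?_
      linear_combination (h.1 + Complex.I * h.2 + (a₁ * Complex.sinh (m₁ * x) -
        a₂ * Complex.sinh (m₂ * x)) * hI) / 2
    · obtain ⟨x, hx, hs⟩ := exists_sinh_mul_ne_zero hm₂0
      refine ⟨x, hx, ?_⟩
      by_contra! h
      refine mul_ne_zero ha hs ?_
      linear_combination (h.1 - Complex.I * h.2 - (a₁ * Complex.sinh (m₁ * x) -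
        a₂ * Complex.sinh (m₂ * x)) * hI) / 2

/-! ### The characteristic determinant -/

/-- The exponents of the modes on the undamped side are `m c l` and `m (-c) l`. -/
def leftExp (a l : ℂ) : ℂ := l * (1 - Complex.I * a / l) ^ (2⁻¹ : ℂ)

/-- A root `d` of `d² - (1 - e) d + c² e / l² = 0`, where `e = 1 / (1 + l)`. -/
def rightRoot (c l : ℂ) : ℂ :=
  ((1 - (1 + l)⁻¹) + ((1 - (1 + l)⁻¹) ^ 2 - 4 * c ^ 2 * (1 + l)⁻¹ / l ^ 2) ^ (2⁻¹ : ℂ)) / 2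

/-- The exponent of the oscillating mode on the damped side. -/
def rightExp (c l : ℂ) : ℂ := l * ((1 + l)⁻¹ + rightRoot c l) ^ (2⁻¹ : ℂ)

/-- The exponent of the damped mode on the damped side. -/
def dampExp (c l : ℂ) : ℂ := ((l ^ 2 + c ^ 2 / rightRoot c l) * (1 + l)⁻¹) ^ (2⁻¹ : ℂ)

/-- The ratio of derivative and value at the interface for the damped mode. -/
def dampRatio (c l : ℂ) : ℂ :=
  dampExp c l * (Complex.cosh (dampExp c l / 2) / Complex.sinh (dampExp c l / 2))

/-- The amplitude ratio of the damped mode. -/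
def dampAmp (c l : ℂ) : ℂ := c / (l * rightRoot c l)

/-- The amplitude ratio of the oscillating mode on the damped side. -/
def rightAmp (c l : ℂ) : ℂ := dampAmp c l * (1 + l)⁻¹

/-- The matrix of the transmission conditions. -/
def charMatrix (c l : ℂ) : Matrix (Fin 4) (Fin 4) ℂ :=
  !![Complex.sinh (leftExp c l / 2), Complex.sinh (leftExp (-c) l / 2),
      -(rightAmp c l * Complex.sinh (rightExp c l / 2)), -1;
    -(Complex.I * Complex.sinh (leftExp c l / 2)), Complex.I * Complex.sinh (leftExp (-c) l / 2),
      -Complex.sinh (rightExp c l / 2), -dampAmp c l;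
    -(Complex.I * (leftExp c l / l * Complex.cosh (leftExp c l / 2))),
      Complex.I * (leftExp (-c) l / l * Complex.cosh (leftExp (-c) l / 2)),
      rightExp c l / l * Complex.cosh (rightExp c l / 2), dampAmp c l * (dampRatio c l / l);
    leftExp c l * (1 + l)⁻¹ * Complex.cosh (leftExp c l / 2) * (dampRatio c l)⁻¹,
      leftExp (-c) l * (1 + l)⁻¹ * Complex.cosh (leftExp (-c) l / 2) * (dampRatio c l)⁻¹,
      rightAmp c l * rightExp c l * Complex.cosh (rightExp c l / 2) * (dampRatio c l)⁻¹, 1]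

lemma cpow_inv_two_sq (z : ℂ) : (z ^ (2⁻¹ : ℂ)) ^ 2 = z := by
  exact_mod_cast Complex.cpow_nat_inv_pow z (n := 2) two_ne_zero

lemma leftExp_sq (a : ℂ) {l : ℂ} (hl : l ≠ 0) :
    leftExp a l ^ 2 = l ^ 2 - Complex.I * a * l := by
  rw [leftExp, mul_pow, cpow_inv_two_sq]
  field_simp

lemma rightRoot_eq (c l : ℂ) :
    rightRoot c l ^ 2 - (1 - (1 + l)⁻¹) * rightRoot c l + c ^ 2 * (1 + l)⁻¹ / l ^ 2 = 0 := by
  have h := cpow_inv_two_sq ((1 - (1 + l)⁻¹) ^ 2 - 4 * c ^ 2 * (1 + l)⁻¹ / l ^ 2)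
  rw [rightRoot]
  linear_combination h / 4

/-- The nondegeneracy conditions under which zeros of the characteristic determinant are
eigenvalues. -/
structure Nondegenerate (c l : ℂ) : Prop where
  ne_zero : l ≠ 0
  add_ne_zero : 1 + l ≠ 0
  root_ne_zero : rightRoot c l ≠ 0
  left_ne_zero : leftExp c l ≠ 0
  left_ne_zero' : leftExp (-c) l ≠ 0
  ratio_ne_zero : dampRatio c l ≠ 0
  sinh_ne_zero : Complex.sinh (dampExp c l / 2) ≠ 0
  right_ne_zero : Complex.sinh (rightExp c l / 2) ≠ 0
  amp_ne_zero : 1 - rightAmp c l * dampAmp c l ≠ 0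

/-- A kernel vector is `(a₁, a₂, b₁, b₂ sinh (n₂ / 2))` in the notation of `isEigenvalue_of_modes`.
The rows express continuity of `u`, of `y`, of `y_x` divided by `l`, and of the flux divided by `(1
+ l)` times `dampRatio`. These scalings give every entry a finite limit at high frequency. -/
theorem isEigenvalue_of_det_eq_zero {c : ℝ} {l : ℂ} (h : Nondegenerate c l)
    (hdet : (charMatrix c l).det = 0) : IsEigenvalue (waveOperator c) l := by
  obtain ⟨x, hx0, hx⟩ := Matrix.exists_mulVec_eq_zero_iff.2 hdet
  have hl := h.ne_zero
  have hl1 := h.add_ne_zero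
  have hd := h.root_ne_zero
  have hK := h.ratio_ne_zero
  have hs := h.sinh_ne_zero
  have r0 := congrFun hx 0
  have r1 := congrFun hx 1
  have r2 := congrFun hx 2
  have r3 := congrFun hx 3
  simp only [charMatrix, Matrix.mulVec, dotProduct, Fin.sum_univ_four, Matrix.of_apply,
    Matrix.cons_val, Pi.zero_apply] at r0 r1 r2 r3
  have hroot := rightRoot_eq c l
  have hn₁ : rightExp c l ^ 2 = l ^ 2 * ((1 + l)⁻¹ + rightRoot c l) := by
    rw [rightExp, mul_pow, cpow_inv_two_sq]
  have hn₂ : dampExp c l ^ 2 = (l ^ 2 + c ^ 2 / rightRoot c l) * (1 + l)⁻¹ := cpow_inv_two_sq _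
  have hKn : dampExp c l * Complex.cosh (dampExp c l / 2) =
      dampRatio c l * Complex.sinh (dampExp c l / 2) := by
    rw [dampRatio]; field_simp
  refine isEigenvalue_of_modes (m₁ := leftExp c l) (m₂ := leftExp (-c) l) (n₁ := rightExp c l)
    (n₂ := dampExp c l) (p := rightAmp c l) (q := dampAmp c l) (a₁ := x 0) (a₂ := x 1)
    (b₁ := x 2) (b₂ := x 3 / Complex.sinh (dampExp c l / 2)) (leftExp_sq c hl) ?_ ?_ ?_ ?_ ?_
    h.left_ne_zero h.left_ne_zero' ?_ ?_ ?_ ?_ ?_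
  · rw [leftExp_sq _ hl]; ring
  · rw [hn₁, rightAmp, dampAmp]
    field_simp at hroot ⊢
    linear_combination hroot
  · rw [hn₁, rightAmp, dampAmp]
    field_simp
  · rw [hn₂, dampAmp]
    field_simp at hroot ⊢
    linear_combination c * hroot
  · rw [hn₂, dampAmp]
    field_simp
  -- If the solution vanishes on the left, the first two rows give `b₁ sinh (n₁ / 2) (1 - p q) = 0`,
  -- so `b₁ = 0`; the first row then kills the last unknown.
  · by_contra! hcon
    obtain ⟨h0, h1⟩ := hcon
    rw [h0, h1] at r0 r1
    have h2 : x 2 = 0 := by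
      refine (mul_eq_zero.1 (?_ : x 2 * (Complex.sinh (rightExp c l / 2) *
        (1 - rightAmp c l * dampAmp c l)) = 0)).resolve_right
        (mul_ne_zero h.right_ne_zero h.amp_ne_zero)
      linear_combination dampAmp c l * r0 - r1
    have h3 : x 3 = 0 := by
      rw [h2] at r0
      linear_combination -r0
    refine hx0 (funext fun i => ?_)
    fin_cases i
    exacts [h0, h1, h2, h3]
  · field_simp
    linear_combination r0
  · field_simp
    linear_combination r1
  · have e : x 3 / Complex.sinh (dampExp c l / 2) * dampExp c l * Complex.cosh (dampExp c l / 2) =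
        x 3 * dampRatio c l := by
      rw [mul_assoc, hKn]; field_simp
    rw [e]
    field_simp at r3
    linear_combination r3
  · have e : x 3 / Complex.sinh (dampExp c l / 2) * dampAmp c l * dampExp c l *
        Complex.cosh (dampExp c l / 2) = x 3 * dampAmp c l * dampRatio c l := by
      rw [mul_assoc, hKn]; field_simp
    rw [e]
    field_simp at r2
    linear_combination r2

/-! ### High frequency asymptotics of the characteristic determinant -/

/-- Spectral parameters which go to infinity along the imaginary axis, and converge up to
translations by multiples of `4πi`. -/
structure IsHighFreq {ι : Type*} (G : Filter ι) (l : ι → ℂ) (k : ι → ℕ) (w : ℂ) : Prop where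
  index : Tendsto k G atTop
  shift : Tendsto (fun i => l i - k i * (4 * Real.pi * Complex.I)) G (𝓝 w)

lemma tendsto_cpow_inv_two {ι : Type*} {G : Filter ι} {f : ι → ℂ} (h : Tendsto f G (𝓝 1)) :
    Tendsto (fun i => f i ^ (2⁻¹ : ℂ)) G (𝓝 1) := by
  have h1 : ContinuousAt (fun z : ℂ => z ^ (2⁻¹ : ℂ)) 1 :=
    continuousAt_id.cpow continuousAt_const Complex.one_mem_slitPlane
  have h2 := h1.tendsto.comp h
  simpa [Function.comp_def] using h2

lemma tendsto_zero_of_sq {ι : Type*} {G : Filter ι} {f : ι → ℂ}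
    (h : Tendsto (fun i => f i ^ 2) G (𝓝 0)) : Tendsto f G (𝓝 0) := by
  rw [tendsto_zero_iff_norm_tendsto_zero] at h ⊢
  have h1 := (Real.continuous_sqrt.tendsto 0).comp h
  simpa [Function.comp_def, Real.sqrt_sq] using h1

/-- Write `coth f = (1 + exp (-2f)) / (1 - exp (-2f))`, where the exponential tends to zero. -/
lemma tendsto_cosh_div_sinh {ι : Type*} {G : Filter ι} {f : ι → ℂ}
    (h : Tendsto (fun i => (f i).re) G atTop) :
    Tendsto (fun i => Complex.cosh (f i) / Complex.sinh (f i)) G (𝓝 1) := by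
  have h1 : Tendsto (fun i => Complex.exp (-(2 * f i))) G (𝓝 0) := by
    rw [tendsto_zero_iff_norm_tendsto_zero]
    simp only [Complex.norm_exp]
    refine Real.tendsto_exp_atBot.comp ?_
    have : ∀ i, (-(2 * f i)).re = -(2 * (f i).re) := fun i => by simp
    simp only [this]
    exact tendsto_neg_atTop_atBot.comp (h.const_mul_atTop two_pos)
  have h2 : Tendsto (fun i => (1 + Complex.exp (-(2 * f i))) / (1 - Complex.exp (-(2 * f i)))) G
      (𝓝 ((1 + 0) / (1 - 0))) :=
    (tendsto_const_nhds.add h1).div (tendsto_const_nhds.sub h1) (by norm_num)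
  have h3 : ((1 : ℂ) + 0) / (1 - 0) = 1 := by norm_num
  rw [h3] at h2
  refine h2.congr fun i => ?_
  have e1 : Complex.exp (-(2 * f i)) = Complex.exp (-(f i)) * Complex.exp (-(f i)) := by
    rw [← Complex.exp_add]; congr 1; ring
  have e2 : Complex.exp (f i) * Complex.exp (-(f i)) = 1 := by
    rw [← Complex.exp_add, add_neg_cancel, Complex.exp_zero]
  have e3 : (1 : ℂ) + Complex.exp (-(2 * f i)) = 2 * Complex.exp (-(f i)) * Complex.cosh (f i) := by
    rw [Complex.cosh, e1]; linear_combination -e2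
  have e4 : (1 : ℂ) - Complex.exp (-(2 * f i)) = 2 * Complex.exp (-(f i)) * Complex.sinh (f i) := by
    rw [Complex.sinh, e1]; linear_combination -e2
  rw [e3, e4, mul_div_mul_left _ _ (mul_ne_zero two_ne_zero (Complex.exp_ne_zero _))]

namespace IsHighFreq

variable {ι : Type*} {G : Filter ι} {l : ι → ℂ} {k : ι → ℕ} {w : ℂ}

/-- As a function of `x`, `exp (x / 2)` has period `4πi`, hence the step of the translations. -/
lemma tendsto_exp_half {w' : ℂ} {x : ι → ℂ}
    (hx : Tendsto (fun i => x i - k i * (4 * Real.pi * Complex.I)) G (𝓝 w')) :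
    Tendsto (fun i => Complex.exp (x i / 2)) G (𝓝 (Complex.exp (w' / 2))) := by
  refine ((Complex.continuous_exp.tendsto _).comp (hx.div_const 2)).congr fun i => ?_
  rw [Function.comp_apply, ← Complex.exp_periodic.nat_mul (k i)]
  congr 1
  ring

lemma tendsto_exp_neg_half {w' : ℂ} {x : ι → ℂ}
    (hx : Tendsto (fun i => x i - k i * (4 * Real.pi * Complex.I)) G (𝓝 w')) :
    Tendsto (fun i => Complex.exp (-(x i / 2))) G (𝓝 (Complex.exp (-(w' / 2)))) := by
  simp only [Complex.exp_neg]
  exact (tendsto_exp_half hx).inv₀ (Complex.exp_ne_zero _)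

lemma tendsto_sinh_half {w' : ℂ} {x : ι → ℂ}
    (hx : Tendsto (fun i => x i - k i * (4 * Real.pi * Complex.I)) G (𝓝 w')) :
    Tendsto (fun i => Complex.sinh (x i / 2)) G (𝓝 (Complex.sinh (w' / 2))) :=
  ((tendsto_exp_half hx).sub (tendsto_exp_neg_half hx)).div_const 2

lemma tendsto_cosh_half {w' : ℂ} {x : ι → ℂ}
    (hx : Tendsto (fun i => x i - k i * (4 * Real.pi * Complex.I)) G (𝓝 w')) :
    Tendsto (fun i => Complex.cosh (x i / 2)) G (𝓝 (Complex.cosh (w' / 2))) :=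
  ((tendsto_exp_half hx).add (tendsto_exp_neg_half hx)).div_const 2

lemma shift_add (h : IsHighFreq G l k w) {x : ι → ℂ} {a : ℂ}
    (hx : Tendsto (fun i => x i - l i) G (𝓝 a)) :
    Tendsto (fun i => x i - k i * (4 * Real.pi * Complex.I)) G (𝓝 (w + a)) :=
  (h.shift.add hx).congr fun i => by ring

lemma re (h : IsHighFreq G l k w) : Tendsto (fun i => (l i).re) G (𝓝 w.re) := by
  refine ((Complex.continuous_re.tendsto _).comp h.shift).congr fun i => ?_
  simp

lemma im (h : IsHighFreq G l k w) : Tendsto (fun i => (l i).im) G atTop := by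
  have h1 : Tendsto (fun i => (k i : ℝ) * (4 * Real.pi)) G atTop :=
    (tendsto_natCast_atTop_atTop.comp h.index).atTop_mul_const (by positivity)
  have h2 := h1.atTop_add ((Complex.continuous_im.tendsto _).comp h.shift)
  refine h2.congr fun i => ?_
  simp

lemma tendsto_inv_of_im {x : ι → ℂ} (hx : Tendsto (fun i => (x i).im) G atTop) :
    Tendsto (fun i => (x i)⁻¹) G (𝓝 0) := by
  refine tendsto_inv₀_cobounded.comp (tendsto_norm_atTop_iff_cobounded.1 ?_)
  exact tendsto_atTop_mono (fun i => (le_abs_self _).trans (Complex.abs_im_le_norm _)) hx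

lemma inv (h : IsHighFreq G l k w) : Tendsto (fun i => (l i)⁻¹) G (𝓝 0) :=
  tendsto_inv_of_im h.im

lemma inv_one_add (h : IsHighFreq G l k w) : Tendsto (fun i => (1 + l i)⁻¹) G (𝓝 0) :=
  tendsto_inv_of_im (by simpa using h.im)

lemma ne_zero (h : IsHighFreq G l k w) : ∀ᶠ i in G, l i ≠ 0 := by
  filter_upwards [h.im.eventually_gt_atTop 0] with i hi h0
  simp [h0] at hi

lemma add_ne_zero (h : IsHighFreq G l k w) : ∀ᶠ i in G, 1 + l i ≠ 0 := by
  filter_upwards [h.im.eventually_gt_atTop 0] with i hi h0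
  have : (1 + l i).im = 0 := by rw [h0]; rfl
  simp at this
  linarith

lemma left_radicand (h : IsHighFreq G l k w) (a : ℂ) :
    Tendsto (fun i => 1 - Complex.I * a / l i) G (𝓝 1) := by
  have := (h.inv.const_mul (Complex.I * a)).const_sub 1
  simpa [div_eq_mul_inv] using this

lemma left_div (h : IsHighFreq G l k w) (a : ℂ) :
    Tendsto (fun i => leftExp a (l i) / l i) G (𝓝 1) := by
  refine (tendsto_cpow_inv_two (h.left_radicand a)).congr' ?_
  filter_upwards [h.ne_zero] with i hi
  rw [leftExp, mul_div_cancel_left₀ _ hi]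

/-- Rationalise: with `s` the square root, `l (s - 1) = l (s² - 1) / (s + 1) = -ia / (s + 1)` and `s
→ 1`. -/
lemma left_sub (h : IsHighFreq G l k w) (a : ℂ) :
    Tendsto (fun i => leftExp a (l i) - l i) G (𝓝 (-(Complex.I * a / 2))) := by
  have hs := tendsto_cpow_inv_two (h.left_radicand a)
  have hs1 : Tendsto (fun i => (1 - Complex.I * a / l i) ^ (2⁻¹ : ℂ) + 1) G (𝓝 (1 + 1)) :=
    hs.add_const 1
  have h1 : Tendsto (fun i => -(Complex.I * a) / ((1 - Complex.I * a / l i) ^ (2⁻¹ : ℂ) + 1)) G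
      (𝓝 (-(Complex.I * a) / (1 + 1))) :=
    tendsto_const_nhds.div hs1 (by norm_num)
  have e : -(Complex.I * a) / (1 + 1) = -(Complex.I * a / 2) := by ring
  rw [e] at h1
  refine h1.congr' ?_
  filter_upwards [h.ne_zero, hs1.eventually_ne (show (1 + 1 : ℂ) ≠ 0 by norm_num)] with i hi hne
  have hsq := cpow_inv_two_sq (1 - Complex.I * a / l i)
  rw [leftExp, div_eq_iff hne]
  set s := (1 - Complex.I * a / l i) ^ (2⁻¹ : ℂ)
  have e1 : (l i * s - l i) * (s + 1) = l i * (1 - Complex.I * a / l i - 1) := by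
    linear_combination l i * hsq
  rw [e1]
  field_simp
  ring

lemma root_radicand (h : IsHighFreq G l k w) (c : ℂ) :
    Tendsto (fun i => (1 - (1 + l i)⁻¹) ^ 2 - 4 * c ^ 2 * (1 + l i)⁻¹ / l i ^ 2) G (𝓝 1) := by
  have h1 := ((h.inv_one_add.const_sub 1).pow 2).sub
    ((h.inv_one_add.const_mul (4 * c ^ 2)).mul (h.inv.pow 2))
  simpa [div_eq_mul_inv] using h1

lemma root (h : IsHighFreq G l k w) (c : ℂ) : Tendsto (fun i => rightRoot c (l i)) G (𝓝 1) := by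
  have h1 := ((h.inv_one_add.const_sub 1).add
    (tendsto_cpow_inv_two (h.root_radicand c))).div_const 2
  have e : ((1 : ℂ) - 0 + 1) / 2 = 1 := by norm_num
  rw [e] at h1
  exact h1

lemma root_ne_zero (h : IsHighFreq G l k w) (c : ℂ) : ∀ᶠ i in G, rightRoot c (l i) ≠ 0 :=
  (h.root c).eventually_ne one_ne_zero

lemma right_radicand (h : IsHighFreq G l k w) (c : ℂ) :
    Tendsto (fun i => (1 + l i)⁻¹ + rightRoot c (l i)) G (𝓝 1) := by
  simpa using h.inv_one_add.add (h.root c)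

lemma right_div (h : IsHighFreq G l k w) (c : ℂ) :
    Tendsto (fun i => rightExp c (l i) / l i) G (𝓝 1) := by
  refine (tendsto_cpow_inv_two (h.right_radicand c)).congr' ?_
  filter_upwards [h.ne_zero] with i hi
  rw [rightExp, mul_div_cancel_left₀ _ hi]

lemma root_inv (h : IsHighFreq G l k w) (c : ℂ) :
    Tendsto (fun i => (rightRoot c (l i))⁻¹) G (𝓝 1) := by
  simpa using (h.root c).inv₀ one_ne_zero

/-- Rationalise again. With `e = 1 / (1 + l)` and `d` the root, the quadratic equation gives `e + d
- 1 = -c² e / (l² d)`, which is small enough to absorb the factor `l`. -/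
lemma right_sub (h : IsHighFreq G l k w) (c : ℂ) :
    Tendsto (fun i => rightExp c (l i) - l i) G (𝓝 0) := by
  have hs := tendsto_cpow_inv_two (h.right_radicand c)
  have hs1 : Tendsto (fun i => ((1 + l i)⁻¹ + rightRoot c (l i)) ^ (2⁻¹ : ℂ) + 1) G
      (𝓝 (1 + 1)) := hs.add_const 1
  have h1 := ((((h.inv_one_add.const_mul (-c ^ 2)).mul h.inv).mul (h.root_inv c))).div hs1
    (by norm_num)
  simp only [mul_zero, zero_mul, zero_div] at h1
  refine h1.congr' ?_
  filter_upwards [h.ne_zero, h.add_ne_zero, h.root_ne_zero c,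
    hs1.eventually_ne (show (1 + 1 : ℂ) ≠ 0 by norm_num)] with i hi hi1 hd hne
  have hsq := cpow_inv_two_sq ((1 + l i)⁻¹ + rightRoot c (l i))
  have hroot := rightRoot_eq c (l i)
  rw [rightExp, Pi.div_apply, div_eq_iff hne]
  set s := ((1 + l i)⁻¹ + rightRoot c (l i)) ^ (2⁻¹ : ℂ)
  have e1 : (l i * s - l i) * (s + 1) = l i * ((1 + l i)⁻¹ + rightRoot c (l i) - 1) := by
    linear_combination l i * hsq
  rw [e1]
  field_simp at hroot ⊢
  linear_combination -hroot

lemma amp (h : IsHighFreq G l k w) (c : ℂ) : Tendsto (fun i => dampAmp c (l i)) G (𝓝 0) := by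
  have h1 := (h.inv.const_mul c).mul (h.root_inv c)
  simp only [mul_zero, zero_mul] at h1
  refine h1.congr fun i => ?_
  rw [dampAmp, div_eq_mul_inv, mul_inv, mul_assoc]

lemma right_amp (h : IsHighFreq G l k w) (c : ℂ) :
    Tendsto (fun i => rightAmp c (l i)) G (𝓝 0) := by
  simpa [rightAmp] using (h.amp c).mul h.inv_one_add

/-- The square of the damped exponent is `l - 1 + o(1)`, so this exponent is of order `√l`: large,
but negligible compared with `l`. -/
lemma damp_radicand_sub (h : IsHighFreq G l k w) (c : ℂ) :
    Tendsto (fun i => (l i ^ 2 + c ^ 2 / rightRoot c (l i)) * (1 + l i)⁻¹ - l i) G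
      (𝓝 (-1)) := by
  have h1 := (((h.root_inv c).const_mul (c ^ 2)).add_const 1).mul h.inv_one_add |>.sub_const 1
  simp only [mul_zero, zero_sub] at h1
  refine h1.congr' ?_
  filter_upwards [h.add_ne_zero, h.root_ne_zero c] with i hi1 hd
  field_simp
  ring

lemma damp_radicand_im (h : IsHighFreq G l k w) (c : ℂ) :
    Tendsto (fun i => ((l i ^ 2 + c ^ 2 / rightRoot c (l i)) * (1 + l i)⁻¹).im) G atTop := by
  refine (h.im.atTop_add
    ((Complex.continuous_im.tendsto _).comp (h.damp_radicand_sub c))).congr fun i => ?_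
  rw [Function.comp_apply, Complex.sub_im, add_sub_cancel]

lemma damp_radicand_re (h : IsHighFreq G l k w) (c : ℂ) :
    Tendsto (fun i => ((l i ^ 2 + c ^ 2 / rightRoot c (l i)) * (1 + l i)⁻¹).re) G
      (𝓝 (w.re + -1)) := by
  refine (h.re.add
    ((Complex.continuous_re.tendsto _).comp (h.damp_radicand_sub c))).congr fun i => ?_
  rw [Function.comp_apply, Complex.sub_re, add_sub_cancel]

/-- The real part of `√ζ` is `√((|ζ| + Re ζ) / 2)`; here `|ζ|` tends to infinity while `Re ζ`
converges. -/
lemma damp_re (h : IsHighFreq G l k w) (c : ℂ) :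
    Tendsto (fun i => (dampExp c (l i)).re) G atTop := by
  simp only [dampExp, Complex.cpow_inv_two_re]
  have h1 : Tendsto (fun i => ‖(l i ^ 2 + c ^ 2 / rightRoot c (l i)) * (1 + l i)⁻¹‖) G atTop :=
    tendsto_atTop_mono (fun i => (le_abs_self _).trans (Complex.abs_im_le_norm _))
      (h.damp_radicand_im c)
  exact Real.tendsto_sqrt_atTop.comp
    ((h1.atTop_add (h.damp_radicand_re c)).atTop_div_const two_pos)

lemma damp_inv (h : IsHighFreq G l k w) (c : ℂ) :
    Tendsto (fun i => (dampExp c (l i))⁻¹) G (𝓝 0) := by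
  refine tendsto_inv₀_cobounded.comp (tendsto_norm_atTop_iff_cobounded.1 ?_)
  exact tendsto_atTop_mono (fun i => Complex.re_le_norm _) (h.damp_re c)

lemma damp_div (h : IsHighFreq G l k w) (c : ℂ) :
    Tendsto (fun i => dampExp c (l i) / l i) G (𝓝 0) := by
  refine tendsto_zero_of_sq ?_
  have h1 := ((h.damp_radicand_sub c).mul (h.inv.pow 2)).add h.inv
  simp only [ne_eq, OfNat.ofNat_ne_zero, not_false_eq_true, zero_pow, mul_zero, add_zero] at h1
  refine h1.congr' ?_
  filter_upwards [h.ne_zero] with i hi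
  rw [div_pow, dampExp, cpow_inv_two_sq]
  field_simp
  ring

lemma coth (h : IsHighFreq G l k w) (c : ℂ) :
    Tendsto (fun i => Complex.cosh (dampExp c (l i) / 2) / Complex.sinh (dampExp c (l i) / 2)) G
      (𝓝 1) := by
  refine tendsto_cosh_div_sinh ?_
  have : ∀ z : ℂ, (z / 2).re = z.re / 2 := fun z => by simp
  simp only [this]
  exact (h.damp_re c).atTop_div_const two_pos

lemma sinh_damp_ne_zero (h : IsHighFreq G l k w) (c : ℂ) :
    ∀ᶠ i in G, Complex.sinh (dampExp c (l i) / 2) ≠ 0 := by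
  filter_upwards [(h.coth c).eventually_ne one_ne_zero] with i hi h0
  simp [h0] at hi

lemma ratio_inv (h : IsHighFreq G l k w) (c : ℂ) :
    Tendsto (fun i => (dampRatio c (l i))⁻¹) G (𝓝 0) := by
  have h1 := (h.damp_inv c).mul ((h.coth c).inv₀ one_ne_zero)
  rw [zero_mul] at h1
  refine h1.congr fun i => ?_
  rw [dampRatio, mul_inv]

lemma ratio_ne_zero (h : IsHighFreq G l k w) (c : ℂ) : ∀ᶠ i in G, dampRatio c (l i) ≠ 0 := by
  filter_upwards [(h.coth c).eventually_ne one_ne_zero,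
    (h.damp_re c).eventually_gt_atTop 0] with i h1 h2
  refine mul_ne_zero (fun h0 => ?_) h1
  simp [h0] at h2

lemma ratio_div (h : IsHighFreq G l k w) (c : ℂ) :
    Tendsto (fun i => dampRatio c (l i) / l i) G (𝓝 0) := by
  have h1 := (h.damp_div c).mul (h.coth c)
  rw [zero_mul] at h1
  refine h1.congr fun i => ?_
  rw [dampRatio]
  ring

lemma mul_inv_one_add (h : IsHighFreq G l k w) : Tendsto (fun i => l i * (1 + l i)⁻¹) G (𝓝 1) := by
  have h1 := h.inv_one_add.const_sub 1
  rw [sub_zero] at h1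
  refine h1.congr' ?_
  filter_upwards [h.add_ne_zero] with i hi
  field_simp
  ring

end IsHighFreq

/-- The limit of the matrix of the transmission conditions. -/
def limitMatrix (c w : ℂ) : Matrix (Fin 4) (Fin 4) ℂ :=
  !![Complex.sinh ((w + -(Complex.I * c / 2)) / 2), Complex.sinh ((w + -(Complex.I * -c / 2)) / 2),
      0, -1;
    -(Complex.I * Complex.sinh ((w + -(Complex.I * c / 2)) / 2)),
      Complex.I * Complex.sinh ((w + -(Complex.I * -c / 2)) / 2), -Complex.sinh (w / 2), 0;
    -(Complex.I * Complex.cosh ((w + -(Complex.I * c / 2)) / 2)),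
      Complex.I * Complex.cosh ((w + -(Complex.I * -c / 2)) / 2), Complex.cosh (w / 2), 0;
    0, 0, 0, 1]

/-- Both amplitude ratios tend to zero, and `dampRatio`, of order `√l`, satisfies both `dampRatio /
l → 0` and `1 / dampRatio → 0`. Hence the last column and the last row decouple, apart from the
constant entries `-1` and `1`. -/
theorem IsHighFreq.tendsto_charMatrix {ι : Type*} {G : Filter ι} {l : ι → ℂ} {k : ι → ℕ} {w : ℂ}
    (h : IsHighFreq G l k w) (c : ℂ) :
    Tendsto (fun i => charMatrix c (l i)) G (𝓝 (limitMatrix c w)) := by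
  have s1 := tendsto_sinh_half (h.shift_add (h.left_sub c))
  have s2 := tendsto_sinh_half (h.shift_add (h.left_sub (-c)))
  have c1 := tendsto_cosh_half (h.shift_add (h.left_sub c))
  have c2 := tendsto_cosh_half (h.shift_add (h.left_sub (-c)))
  have hr := h.shift_add (h.right_sub c)
  rw [add_zero] at hr
  have s3 := tendsto_sinh_half hr
  have c3 := tendsto_cosh_half hr
  have q := h.ratio_inv c
  have left : ∀ a, Tendsto (fun i => leftExp a (l i) * (1 + l i)⁻¹) G (𝓝 1) := by
    intro a
    have h1 := (h.left_div a).mul h.mul_inv_one_add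
    rw [one_mul] at h1
    refine h1.congr' ?_
    filter_upwards [h.ne_zero] with i hi
    rw [← mul_assoc, div_mul_cancel₀ _ hi]
  have right : Tendsto (fun i => rightAmp c (l i) * rightExp c (l i)) G (𝓝 0) := by
    have h1 := (h.amp c).mul ((h.right_div c).mul h.mul_inv_one_add)
    rw [zero_mul] at h1
    refine h1.congr' ?_
    filter_upwards [h.ne_zero] with i hi
    rw [rightAmp]
    field_simp
  refine tendsto_pi_nhds.2 fun i => tendsto_pi_nhds.2 fun j => ?_
  fin_cases i <;> fin_cases j
  · exact s1
  · exact s2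
  · simpa using! ((h.right_amp c).mul s3).neg
  · exact tendsto_const_nhds
  · exact (s1.const_mul _).neg
  · exact s2.const_mul _
  · exact s3.neg
  · simpa using! (h.amp c).neg
  · have e := (((h.left_div c).mul c1).const_mul Complex.I).neg
    rw [one_mul] at e
    exact e
  · have e := ((h.left_div (-c)).mul c2).const_mul Complex.I
    rw [one_mul] at e
    exact e
  · simpa using! (h.right_div c).mul c3
  · simpa using! (h.amp c).mul (h.ratio_div c)
  · simpa using! ((left c).mul c1).mul q
  · simpa using! ((left (-c)).mul c2).mul q
  · simpa using! (right.mul c3).mul q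
  · exact tendsto_const_nhds

theorem IsHighFreq.tendsto_det {ι : Type*} {G : Filter ι} {l : ι → ℂ} {k : ι → ℕ} {w : ℂ}
    (h : IsHighFreq G l k w) (c : ℂ) :
    Tendsto (fun i => (charMatrix c (l i)).det) G (𝓝 (limitMatrix c w).det) :=
  ((continuous_id.matrix_det).tendsto (limitMatrix c w)).comp (h.tendsto_charMatrix c)

/-- Only `right_ne_zero` depends on the limit point `w`; the other conditions hold at all high
frequencies. -/
theorem IsHighFreq.nondegenerate {ι : Type*} {G : Filter ι} {l : ι → ℂ} {k : ι → ℕ} {w : ℂ}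
    (h : IsHighFreq G l k w) (c : ℂ) (hw : Complex.sinh (w / 2) ≠ 0) :
    ∀ᶠ i in G, Nondegenerate c (l i) := by
  have hr := h.shift_add (h.right_sub c)
  rw [add_zero] at hr
  have hamp := ((h.right_amp c).mul (h.amp c)).const_sub 1
  rw [zero_mul, sub_zero] at hamp
  filter_upwards [h.ne_zero, h.add_ne_zero, h.root_ne_zero c,
    (h.left_div c).eventually_ne one_ne_zero, (h.left_div (-c)).eventually_ne one_ne_zero,
    h.ratio_ne_zero c, h.sinh_damp_ne_zero c, (tendsto_sinh_half hr).eventually_ne hw,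
    hamp.eventually_ne one_ne_zero] with i h1 h2 h3 h4 h5 h6 h7 h8 h9
  exact ⟨h1, h2, h3, fun h0 => h4 (by rw [h0, zero_div]), fun h0 => h5 (by rw [h0, zero_div]),
    h6, h7, h8, h9⟩

/-! ### Holomorphy of the characteristic determinant -/

lemma differentiableAt_matrix_det {n : Type*} [Fintype n] [DecidableEq n]
    {M : ℂ → Matrix n n ℂ} {z₀ : ℂ}
    (h : ∀ a b, DifferentiableAt ℂ (fun z => M z a b) z₀) :
    DifferentiableAt ℂ (fun z => (M z).det) z₀ := by
  simp only [Matrix.det_apply]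
  refine DifferentiableAt.fun_sum fun σ _ => DifferentiableAt.fun_const_smul
    (DifferentiableAt.fun_finsetProd fun j _ => h _ _) _

/-- The hypotheses keep every principal square root off its branch cut. At high frequency four of
the radicands tend to `1`; the fifth, that of the damped exponent, goes to infinity with positive
imaginary part. -/
lemma differentiableAt_charMatrix_det {c z₀ : ℂ} (h0 : z₀ ≠ 0) (h1 : 1 + z₀ ≠ 0)
    (hd : rightRoot c z₀ ≠ 0) (hK : dampRatio c z₀ ≠ 0)
    (hs : Complex.sinh (dampExp c z₀ / 2) ≠ 0)
    (k1 : 1 - Complex.I * c / z₀ ∈ Complex.slitPlane)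
    (k2 : 1 - Complex.I * -c / z₀ ∈ Complex.slitPlane)
    (k3 : (1 - (1 + z₀)⁻¹) ^ 2 - 4 * c ^ 2 * (1 + z₀)⁻¹ / z₀ ^ 2 ∈ Complex.slitPlane)
    (k4 : (1 + z₀)⁻¹ + rightRoot c z₀ ∈ Complex.slitPlane)
    (k5 : 0 < ((z₀ ^ 2 + c ^ 2 / rightRoot c z₀) * (1 + z₀)⁻¹).im) :
    DifferentiableAt ℂ (fun z => (charMatrix c z).det) z₀ := by
  have inv1 : DifferentiableAt ℂ (fun z : ℂ => (1 + z)⁻¹) z₀ := by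
    fun_prop (disch := assumption)
  have left : ∀ a, 1 - Complex.I * a / z₀ ∈ Complex.slitPlane →
      DifferentiableAt ℂ (fun z => leftExp a z) z₀ := fun a ha => by
    unfold leftExp
    fun_prop (disch := assumption)
  have l1 := left c k1
  have l2 := left (-c) k2
  have z2 : z₀ ^ 2 ≠ 0 := pow_ne_zero 2 h0
  have rt : DifferentiableAt ℂ (fun z => rightRoot c z) z₀ := by
    unfold rightRoot
    fun_prop (disch := assumption)
  have rx : DifferentiableAt ℂ (fun z => rightExp c z) z₀ := by
    unfold rightExp
    fun_prop (disch := assumption)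
  have k6 : (z₀ ^ 2 + c ^ 2 / rightRoot c z₀) * (1 + z₀)⁻¹ ∈ Complex.slitPlane := Or.inr k5.ne'
  have dx : DifferentiableAt ℂ (fun z => dampExp c z) z₀ := by
    unfold dampExp
    fun_prop (disch := assumption)
  have dr : DifferentiableAt ℂ (fun z => dampRatio c z) z₀ := by
    unfold dampRatio
    fun_prop (disch := assumption)
  have ri : DifferentiableAt ℂ (fun z => (dampRatio c z)⁻¹) z₀ := dr.inv hK
  have zd : z₀ * rightRoot c z₀ ≠ 0 := mul_ne_zero h0 hd
  have da : DifferentiableAt ℂ (fun z => dampAmp c z) z₀ := by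
    unfold dampAmp
    fun_prop (disch := assumption)
  have ra : DifferentiableAt ℂ (fun z => rightAmp c z) z₀ := da.mul inv1
  have quot : ∀ {f : ℂ → ℂ}, DifferentiableAt ℂ f z₀ →
      DifferentiableAt ℂ (fun z => f z / z) z₀ := fun hf => hf.div differentiableAt_id h0
  refine differentiableAt_matrix_det fun a b => ?_
  fin_cases a <;> fin_cases b
  · exact (l1.div_const 2).csinh
  · exact (l2.div_const 2).csinh
  · exact (ra.mul (rx.div_const 2).csinh).neg
  · exact differentiableAt_const _
  · exact ((l1.div_const 2).csinh.const_mul _).neg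
  · exact (l2.div_const 2).csinh.const_mul _
  · exact (rx.div_const 2).csinh.neg
  · exact da.neg
  · exact (((quot l1).mul (l1.div_const 2).ccosh).const_mul _).neg
  · exact ((quot l2).mul (l2.div_const 2).ccosh).const_mul _
  · exact (quot rx).mul (rx.div_const 2).ccosh
  · exact da.mul (quot dr)
  · exact ((l1.mul inv1).mul (l1.div_const 2).ccosh).mul ri
  · exact ((l2.mul inv1).mul (l2.div_const 2).ccosh).mul ri
  · exact ((ra.mul rx).mul (rx.div_const 2).ccosh).mul ri
  · exact differentiableAt_const _

theorem IsHighFreq.differentiableAt_det {ι : Type*} {G : Filter ι} {l : ι → ℂ} {k : ι → ℕ} {w : ℂ}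
    (h : IsHighFreq G l k w) (c : ℂ) :
    ∀ᶠ i in G, DifferentiableAt ℂ (fun z => (charMatrix c z).det) (l i) := by
  have hslit : ∀ᶠ z : ℂ in 𝓝 1, z ∈ Complex.slitPlane :=
    Complex.isOpen_slitPlane.mem_nhds Complex.one_mem_slitPlane
  filter_upwards [h.ne_zero, h.add_ne_zero, h.root_ne_zero c, h.ratio_ne_zero c,
    h.sinh_damp_ne_zero c, (h.left_radicand c).eventually hslit,
    (h.left_radicand (-c)).eventually hslit, (h.root_radicand c).eventually hslit,
    (h.right_radicand c).eventually hslit,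
    (h.damp_radicand_im c).eventually_gt_atTop 0] with i h0 h1 hd hK hs k1 k2 k3 k4 k5
  exact differentiableAt_charMatrix_det h0 h1 hd hK hs k1 k2 k3 k4 k5

/-! ### The limiting determinant -/

lemma det_interface (a b x y s t : ℂ) :
    Matrix.det !![a, b, 0, -1; -(Complex.I * a), Complex.I * b, -s, 0;
      -(Complex.I * x), Complex.I * y, t, 0; 0, 0, 0, 1] =
    Complex.I * (2 * (a * b) * t + s * (a * y + b * x)) := by
  rw [Matrix.det_succ_row _ (3 : Fin 4)]
  simp [Fin.sum_univ_succ, Matrix.det_fin_three, Fin.succAbove]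
  ring

/-- The limiting determinant, shifted to its zero `πi`. -/
lemma limitMatrix_det (c z : ℂ) : (limitMatrix c (Real.pi * Complex.I + z)).det =
    Complex.sinh (z / 2) * (4 * Complex.sinh (z / 2) ^ 2 + 3 + Complex.cos (c / 2)) := by
  have hI : Complex.I ^ 2 = -1 := Complex.I_sq
  -- The addition formulas, together with the quarter-period shift `πi/2` that exchanges `sinh` and
  -- `cosh`, reduce everything to functions of `z / 2` and `c / 4`.
  have e1 : (Real.pi * Complex.I + z + -(Complex.I * c / 2)) / 2 =
      (Real.pi / 2 * Complex.I + z / 2) - c / 4 * Complex.I := by ring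
  have e2 : (Real.pi * Complex.I + z + -(Complex.I * -c / 2)) / 2 =
      (Real.pi / 2 * Complex.I + z / 2) + c / 4 * Complex.I := by ring
  have e3 : (Real.pi * Complex.I + z) / 2 = Real.pi / 2 * Complex.I + z / 2 := by ring
  have e4 : Complex.cos (c / 2) = 2 * Complex.cos (c / 4) ^ 2 - 1 := by
    rw [← Complex.cos_two_mul]; congr 1; ring
  have sA : Complex.sinh (Real.pi / 2 * Complex.I + z / 2) =
      Complex.I * Complex.cosh (z / 2) := by
    rw [Complex.sinh_add, Complex.sinh_mul_I, Complex.cosh_mul_I, Complex.sin_pi_div_two,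
      Complex.cos_pi_div_two]
    ring
  have cA : Complex.cosh (Real.pi / 2 * Complex.I + z / 2) =
      Complex.I * Complex.sinh (z / 2) := by
    rw [Complex.cosh_add, Complex.sinh_mul_I, Complex.cosh_mul_I, Complex.sin_pi_div_two,
      Complex.cos_pi_div_two]
    ring
  generalize Real.pi / 2 * Complex.I + z / 2 = A at e1 e2 e3 sA cA
  have hC := Complex.cosh_sq_sub_sinh_sq (z / 2)
  have hc := Complex.sin_sq_add_cos_sq (c / 4)
  rw [limitMatrix, det_interface, e1, e2, e3, Complex.sinh_sub, Complex.sinh_add,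
    Complex.cosh_sub, Complex.cosh_add, sA, cA,
    Complex.sinh_mul_I, Complex.cosh_mul_I, e4]
  set S := Complex.sinh (z / 2)
  set C := Complex.cosh (z / 2)
  set k := Complex.cos (c / 4)
  set s := Complex.sin (c / 4)
  have hI4 : Complex.I ^ 4 = 1 := Complex.I_pow_four
  have hI6 : Complex.I ^ 6 = -1 := by rw [show (6 : ℕ) = 4 + 2 from rfl, pow_add, hI4, hI, one_mul]
  ring_nf
  simp only [hI4, hI6]
  have hC' : C ^ 2 = 1 + S ^ 2 := by linear_combination hC
  have hs' : s ^ 2 = 1 - k ^ 2 := by linear_combination hc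
  simp only [hC', hs']
  ring

/-! ### Existence of eigenvalues -/

/-- Combined with compactness of `K`, this turns statements local in `z` into statements uniform on
`K` for large `n`. -/
lemma eventually_forall_of_prod_nhdsSet {P : ℕ × ℂ → Prop} {K : Set ℂ}
    (h : {p | P p} ∈ (atTop : Filter ℕ) ×ˢ 𝓝ˢ K) : ∀ᶠ n in atTop, ∀ z ∈ K, P (n, z) := by
  obtain ⟨p, hp, q, hq, hpq⟩ := eventually_prod_iff.1 h
  exact hp.mono fun n hn z hz => hpq hn (hq.self_of_nhdsSet z hz)

/-- Hurwitz's theorem: zeros persist under locally uniform convergence. -/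
lemma eventually_exists_zero {F : ℕ → ℂ → ℂ} {f : ℂ → ℂ} {r : ℝ} (hr : 0 < r)
    (hf : Continuous f) (f0 : f 0 = 0) (hne : ∀ z ∈ Metric.sphere (0 : ℂ) r, f z ≠ 0)
    (hlim : ∀ z ∈ Metric.closedBall (0 : ℂ) r,
      Tendsto (fun p : ℕ × ℂ => F p.1 p.2) (atTop ×ˢ 𝓝 z) (𝓝 (f z)))
    (hd : ∀ z ∈ Metric.closedBall (0 : ℂ) r,
      ∀ᶠ p : ℕ × ℂ in atTop ×ˢ 𝓝 z, DifferentiableAt ℂ (F p.1) p.2) :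
    ∀ᶠ n in atTop, ∃ z ∈ Metric.closedBall (0 : ℂ) r, F n z = 0 := by
  -- With `ε` the minimum of `|f|` on the circle, `F n` will be within `ε / 2` of `f` on the closed
  -- disc.
  obtain ⟨x, hx, hmin⟩ := (isCompact_sphere (0 : ℂ) r).exists_isMinOn
    (NormedSpace.sphere_nonempty.2 hr.le) hf.norm.continuousOn
  set ε := ‖f x‖ with hε
  have hε0 : 0 < ε := norm_pos_iff.2 (hne x hx)
  have hev : ∀ z ∈ Metric.closedBall (0 : ℂ) r, ∀ᶠ p : ℕ × ℂ in atTop ×ˢ 𝓝 z,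
      DifferentiableAt ℂ (F p.1) p.2 ∧ dist (F p.1 p.2) (f p.2) < ε / 2 := by
    intro z hz
    refine (hd z hz).and ?_
    have h1 := (hlim z hz).dist ((hf.tendsto z).comp tendsto_snd)
    rw [dist_self] at h1
    exact h1.eventually (gt_mem_nhds (half_pos hε0))
  have hall := (isCompact_closedBall (0 : ℂ) r).mem_prod_nhdsSet_of_forall hev
  filter_upwards [eventually_forall_of_prod_nhdsSet hall] with n hn
  -- Without a zero, `1 / F n` is holomorphic on the disc and at most `2 / ε` on the circle. The
  -- maximum principle gives the same bound at the centre, where `f 0 = 0` forces `|F n 0| < ε / 2`.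
  by_contra! hcon
  have hdiff : DiffContOnCl ℂ (fun z => (F n z)⁻¹) (Metric.ball (0 : ℂ) r) := by
    refine DifferentiableOn.diffContOnCl fun z hz => ?_
    rw [closure_ball _ hr.ne'] at hz
    exact ((hn z hz).1.inv (hcon z hz)).differentiableWithinAt
  have hbd : ∀ z ∈ frontier (Metric.ball (0 : ℂ) r), ‖(F n z)⁻¹‖ ≤ (ε / 2)⁻¹ := by
    intro z hz
    rw [frontier_ball _ hr.ne'] at hz
    have h1 := (hn z (Metric.sphere_subset_closedBall hz)).2
    have h2 : ε ≤ ‖f z‖ := hmin hz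
    rw [dist_comm, dist_eq_norm] at h1
    rw [norm_inv]
    refine inv_anti₀ (half_pos hε0) ?_
    linarith [norm_sub_norm_le (f z) (F n z)]
  have h0 := Complex.norm_le_of_forall_mem_frontier_norm_le Metric.isBounded_ball hdiff hbd
    (subset_closure (Metric.mem_ball_self hr))
  have h0m := Metric.mem_closedBall_self (x := (0 : ℂ)) hr.le
  have h1 := (hn 0 h0m).2
  rw [f0, dist_zero_right] at h1
  rw [norm_inv] at h0
  have h2 := norm_pos_iff.2 (hcon 0 h0m)
  exact absurd ((inv_le_inv₀ h2 (half_pos hε0)).1 h0) (not_le.2 h1)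

/-- Points near `πi + 4πni` tend to infinity along the imaginary axis. -/
lemma isHighFreq_shift (z : ℂ) :
    IsHighFreq (atTop ×ˢ 𝓝 z)
      (fun p : ℕ × ℂ => Real.pi * Complex.I + p.2 + p.1 * (4 * Real.pi * Complex.I))
      (fun p => p.1) (Real.pi * Complex.I + z) where
  index := tendsto_fst
  shift := by
    simp only [add_sub_cancel_right]
    exact tendsto_const_nhds.add tendsto_snd

/-- The factor `sinh (z / 2)` has a simple zero at `0`, and the other factor equals `3 + cos (c / 2)
≥ 2` there, because `c` is real. -/
lemma limitMatrix_det_eventually_ne (c : ℝ) :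
    ∀ᶠ z in 𝓝[≠] (0 : ℂ), (limitMatrix c (Real.pi * Complex.I + z)).det ≠ 0 := by
  have h1 : HasDerivAt (fun z : ℂ => Complex.sinh (z / 2)) (1 / 2) 0 := by
    have := ((hasDerivAt_id (0 : ℂ)).div_const 2).csinh
    simpa using! this
  have h2 : ContinuousAt
      (fun z : ℂ => 4 * Complex.sinh (z / 2) ^ 2 + 3 + Complex.cos ((c : ℂ) / 2)) 0 := by
    fun_prop
  have h3 : 4 * Complex.sinh (0 / 2) ^ 2 + 3 + Complex.cos ((c : ℂ) / 2) ≠ 0 := by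
    have e : 4 * Complex.sinh (0 / 2) ^ 2 + 3 + Complex.cos ((c : ℂ) / 2) =
        ((3 + Real.cos (c / 2) : ℝ) : ℂ) := by
      push_cast
      simp
    rw [e]
    have := Real.neg_one_le_cos (c / 2)
    exact_mod_cast (by linarith : (0 : ℝ) < 3 + Real.cos (c / 2)).ne'
  filter_upwards [h1.eventually_ne (c := 0) (by norm_num),
    (h2.eventually_ne h3).filter_mono nhdsWithin_le_nhds] with z hz1 hz2
  rw [limitMatrix_det]
  exact mul_ne_zero hz1 hz2

/-- There are eigenvalues arbitrarily far from the origin and close to the imaginary axis. -/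
theorem exists_isEigenvalue (c : ℝ) (R : ℝ) {r : ℝ} (hr : 0 < r) :
    ∃ l : ℂ, IsEigenvalue (waveOperator c) l ∧ R ≤ ‖l‖ ∧ |l.re| ≤ r := by
  have hcosh : ∀ᶠ z in 𝓝 (0 : ℂ), Complex.sinh ((Real.pi * Complex.I + z) / 2) ≠ 0 := by
    have : ContinuousAt (fun z : ℂ => Complex.sinh ((Real.pi * Complex.I + z) / 2)) 0 := by
      fun_prop
    refine this.eventually_ne ?_
    have e : (Real.pi * Complex.I + 0) / 2 = Real.pi / 2 * Complex.I := by ring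
    rw [e, Complex.sinh_mul_I, Complex.sin_pi_div_two, one_mul]
    exact Complex.I_ne_zero
  obtain ⟨ρ, hρ, hball⟩ := Metric.nhds_basis_closedBall.eventually_iff.1
    (hcosh.and (eventually_nhdsWithin_iff.1 (limitMatrix_det_eventually_ne c)))
  -- The radius `ρ` isolates the zero and keeps the nondegeneracy condition; `r` bounds the real
  -- part.
  set s := min r ρ with hs
  have hs0 : 0 < s := lt_min hr hρ
  have hsub : Metric.closedBall (0 : ℂ) s ⊆ Metric.closedBall 0 ρ :=
    Metric.closedBall_subset_closedBall (min_le_right _ _)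
  have hcont : Continuous fun z : ℂ => (limitMatrix c (Real.pi * Complex.I + z)).det := by
    simp only [limitMatrix_det]
    fun_prop
  have hzero := eventually_exists_zero
    (F := fun n z => (charMatrix c (Real.pi * Complex.I + z + n * (4 * Real.pi * Complex.I))).det)
    hs0 hcont (by rw [limitMatrix_det]; simp)
    (fun z hz => (hball (hsub (Metric.sphere_subset_closedBall hz))).2
      (Metric.ne_of_mem_sphere hz hs0.ne'))
    (fun z _ => (isHighFreq_shift z).tendsto_det c)
    (fun z _ => ((isHighFreq_shift z).differentiableAt_det c).mono fun p hp =>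
      hp.comp p.2 (f := fun z : ℂ => Real.pi * Complex.I + z + p.1 * (4 * Real.pi * Complex.I))
        (by fun_prop))
  have hgood := eventually_forall_of_prod_nhdsSet
    ((isCompact_closedBall (0 : ℂ) s).mem_prod_nhdsSet_of_forall fun z hz =>
    ((isHighFreq_shift z).nondegenerate c (hball (hsub hz)).1).and
      (((isHighFreq_shift z).im.eventually_ge_atTop R).mono fun _ hp =>
        hp.trans ((le_abs_self _).trans (Complex.abs_im_le_norm _))))
  obtain ⟨n, ⟨z, hz, hdet⟩, hn⟩ := (hzero.and hgood).exists
  obtain ⟨hnd, hR⟩ := hn z hz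
  refine ⟨_, isEigenvalue_of_det_eq_zero hnd hdet, hR, ?_⟩
  -- The discs are centred on the imaginary axis, so the real part of the eigenvalue is that of `z`.
  have hre : (Real.pi * Complex.I + z + n * (4 * Real.pi * Complex.I)).re = z.re := by simp
  rw [hre]
  rw [mem_closedBall_zero_iff] at hz
  exact (Complex.abs_re_le_norm z).trans (hz.trans (min_le_left _ _))

end KelvinVoigt

end

/-! ### Conclusion -/

theorem mainTheorem4 (c : ℝ) :
    -- the wave operator generates a strongly continuous semigroup of contractions
    (∃ T : ℝ≥0 → KelvinVoigt.EnergySpace →L[ℂ] KelvinVoigt.EnergySpace,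
      KelvinVoigt.IsC0Semigroup T ∧ (∀ t, ‖T t‖ ≤ 1) ∧
        KelvinVoigt.IsGenerator (KelvinVoigt.waveOperator c) T) ∧
    -- the semigroup which it generates is not exponentially stable
    (∀ T : ℝ≥0 → KelvinVoigt.EnergySpace →L[ℂ] KelvinVoigt.EnergySpace,
      KelvinVoigt.IsC0Semigroup T →
        KelvinVoigt.IsGenerator (KelvinVoigt.waveOperator c) T → ¬ KelvinVoigt.IsExpStable T) ∧
    -- there are eigenvalues, tending to infinity, whose real parts tend to zero
    (∃ l : ℕ → ℂ, (∀ n, KelvinVoigt.IsEigenvalue (KelvinVoigt.waveOperator c) (l n)) ∧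
      Tendsto (fun n => ‖l n‖) atTop atTop ∧ Tendsto (fun n => (l n).re) atTop (𝓝 0)) := by
  refine ⟨(KelvinVoigt.isMaxDissipative_waveOperator c).exists_semigroup, ?_, ?_⟩
  · intro T hT hA hs
    obtain ⟨ε, hε, h⟩ := hs.exists_re_le hT hA
    -- An eigenvalue with `Re l ≥ -ε / 2` contradicts `Re l ≤ -ε`; its size is irrelevant here.
    obtain ⟨l, hl, -, hre⟩ := KelvinVoigt.exists_isEigenvalue c 0 (half_pos hε)
    have h1 := h l hl
    have h2 := (abs_le.1 hre).1
    linarith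
  -- Take `‖l n‖ ≥ n` and `|Re (l n)| ≤ 1 / (n + 1)`.
  · choose l hl hnorm hre using fun n : ℕ =>
      KelvinVoigt.exists_isEigenvalue c n (Nat.one_div_pos_of_nat (α := ℝ) (n := n))
    exact ⟨l, hl, tendsto_atTop_mono hnorm tendsto_natCast_atTop_atTop,
      squeeze_zero_norm hre tendsto_one_div_add_atTop_nhds_zero_nat⟩
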